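/- A graph is a finite graph without loops, possibly with multiple edges. For a directed graph $g$ with vertices $1,\dots,n$ and $a_{ij}$ edges from $i$ to $j$, let $P_g(x_1,\dots,x_n)=\prod_{i,j}(x_i-x_j)^{a_{ij}}\in\mathbb{R}[x_1,\dots,x_n]$, and let $\tilde g=\sum_{\sigma\in S_n}P_g(x_{\sigma(1)},\dots,x_{\sigma(n)})$ be its symmetrized graph monomial. For an undirected graph, $\tilde g$ is defined up to sign by choosing an orientation of the edges; we call the graph non-negative (resp. SOS) if, for a suitable choice of the sign, $\tilde g$ is non-negative on $\mathbb{R}^n$ (resp. is a sum of squares of polynomials). For $N\ge n$, let $\tilde g_N$ be the symmetrized graph monomial in $N$ variables of $g$ with $N-n$ isolated vertices appended. A square graph is a graph all of whose edges have even multiplicity. The Lax graph $L$ is the star with $4$ simple edges (on $5$ vertices). Let $T$ be the star on $4$ vertices with three leaves in which one edge is doubled. Both are directed away from their centers. Consider graphs with $4$ edges (counted with multiplicity) and without isolated vertices, up to isomorphism. There are $23$ of them. (i) For exactly $10$ of them $\tilde g$ vanishes identically. (ii) The remaining $13$ graphs are divided into $4$ equivalence classes $C_0,C_1,C_2,C_3$,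 consisting of $3,8,1,1$ graphs, with $C_2=\{T\}$ and $C_3=\{L\}$: if $g$ and $h$ are two of these graphs and $N$ is at least the number of vertices of each of them, then $\tilde g_N$ and $\tilde h_N$ are both not identically zero and proportional if and only if $g$ and $h$ lie in the same class. (iii) Each of $C_0$ and $C_1$ contains a square graph, and for every $g$ in these two classes and every $N$ at least the number of vertices of $g$, $\tilde g_N$ is, for a suitable choice of the sign, a sum of squares and therefore non-negative. (iv) There are a square graph $S$ with $4$ edges and at most $5$ vertices, oriented with all $a_{ij}$ even, and real numbers $\alpha,\beta>0$ such that $\tilde T_N=\alpha\tilde L_N+\beta\tilde S_N$ for all $N\ge 5$. The polynomial $\tilde T$ in $x_1,\dots,x_4$ effectively depends on three variables only, i.e. it is a polynomial in $x_1-x_4$, $x_2-x_4$, $x_3-x_4$. For all $N\ge4$, $\tilde T_N$ is non-negative and a sum of squares. (v) $\tilde L_N$ is non-negative for all $N\ge5$, and the Lax graph is, up to isomorphism, the only graph with $4$ edges and without isolated vertices that is non-negative but not SOS (the polynomials being taken in the variables attached to the vertices of the graph). -/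

import Mathlib

open MvPolynomial

namespace SymGraph

/-- An undirected loopless graph with multiple edges allowed, given by the multiplicities
of its edges. -/
structure Multigraph (V : Type) where
  mult : Sym2 V → ℕ
  loopless : ∀ v, mult s(v, v) = 0

/-- A directed loopless graph with multiple edges allowed: `adj u v` is the number of
edges from `u` to `v`. -/
structure DiMultigraph (V : Type) where
  adj : V → V → ℕ
  loopless : ∀ v, adj v v = 0

namespace Multigraph

variable {V W : Type}

/-- The number of edges, counted with multiplicity. -/
def numEdges [Fintype V] [DecidableEq V] (G : Multigraph V) : ℕ := ∑ e : Sym2 V, G.mult e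

def NoIsolated (G : Multigraph V) : Prop := ∀ v, ∃ w, G.mult s(v, w) ≠ 0

/-- All edges have even multiplicity. -/
def IsSquareGraph (G : Multigraph V) : Prop := ∀ e, Even (G.mult e)

def Iso (G : Multigraph V) (H : Multigraph W) : Prop :=
  ∃ f : V ≃ W, ∀ u v, H.mult s(f u, f v) = G.mult s(u, v)

end Multigraph

namespace DiMultigraph

variable {V : Type}

/-- Forget the directions of the edges. -/
def toMultigraph (D : DiMultigraph V) : Multigraph V where
  mult := Sym2.lift ⟨fun u v => D.adj u v + D.adj v u, fun _ _ => Nat.add_comm _ _⟩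
  loopless v := by simp [D.loopless]

/-- `D` is obtained from `G` by choosing a direction for every edge. -/
def IsOrientationOf (D : DiMultigraph V) (G : Multigraph V) : Prop := D.toMultigraph = G

/-- The graph monomial `∏ (x_i - x_j) ^ a_ij`. -/
noncomputable def graphMonomial [Fintype V] (D : DiMultigraph V) : MvPolynomial V ℝ :=
  ∏ i, ∏ j, (X i - X j) ^ D.adj i j

/-- The symmetrized graph monomial, the sum over all permutations of the variables. -/
noncomputable def symMonomial [Fintype V] [DecidableEq V] (D : DiMultigraph V) :
    MvPolynomial V ℝ :=
  ∑ σ : Equiv.Perm V, rename σ D.graphMonomial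

/-- For `n ≤ N`, the graph `D` with `N - n` isolated vertices appended. -/
def pad {n : ℕ} (D : DiMultigraph (Fin n)) (N : ℕ) : DiMultigraph (Fin N) where
  adj i j := if h : i.1 < n ∧ j.1 < n then D.adj ⟨i.1, h.1⟩ ⟨j.1, h.2⟩ else 0
  loopless i := by
    split_ifs
    · exact D.loopless _
    · rfl

/-- Appending no vertex changes nothing. -/
theorem pad_self {n : ℕ} (D : DiMultigraph (Fin n)) : D.pad n = D := by
  cases D
  simp [pad]

/-- The directed graph on `n` vertices with the given list of edges (loops are dropped). -/
def ofList {n : ℕ} (l : List (Fin n × Fin n)) : DiMultigraph (Fin n) where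
  adj i j := if i = j then 0 else l.count (i, j)
  loopless i := by simp

end DiMultigraph

/-- A graph with `d` edges and without isolated vertices, on the vertex set `Fin n`
for some `n`. -/
structure EdgeGraph (d : ℕ) where
  n : ℕ
  graph : Multigraph (Fin n)
  numEdges_eq : graph.numEdges = d
  noIsolated : graph.NoIsolated

namespace EdgeGraph

variable {d : ℕ}

/-- Graphs are identified up to isomorphism. -/
instance isoSetoid (d : ℕ) : Setoid (EdgeGraph d) where
  r G H := G.graph.Iso H.graph
  iseqv :=
    { refl := fun _ => ⟨Equiv.refl _, fun _ _ => rfl⟩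
      symm := fun ⟨f, hf⟩ => ⟨f.symm, fun u v => by
        simpa using (hf (f.symm u) (f.symm v)).symm⟩
      trans := fun ⟨f, hf⟩ ⟨g, hg⟩ => ⟨f.trans g, fun u v => by
        simpa using (hg (f u) (f v)).trans (hf u v)⟩ }

/-- The number of isomorphism classes of graphs in a set of graphs. -/
noncomputable def isoCount (S : Set (EdgeGraph d)) : ℕ :=
  ((Quotient.mk (isoSetoid d)) '' S).ncard

/-- The symmetrized graph monomial (defined up to sign by the choice of an orientation)
vanishes identically. -/
def Vanishes (G : EdgeGraph d) : Prop :=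
  ∀ D : DiMultigraph (Fin G.n), D.IsOrientationOf G.graph → D.symMonomial = 0

/-- After appending isolated vertices to have `N` vertices, both symmetrized graph
monomials are not identically zero and they are proportional. -/
def EquivalentAt (N : ℕ) (G H : EdgeGraph d) : Prop :=
  ∀ (D : DiMultigraph (Fin G.n)) (E : DiMultigraph (Fin H.n)),
    D.IsOrientationOf G.graph → E.IsOrientationOf H.graph →
      (D.pad N).symMonomial ≠ 0 ∧ (E.pad N).symMonomial ≠ 0 ∧
        ∃ c : ℝ, (D.pad N).symMonomial = c • (E.pad N).symMonomial

/-- After appending isolated vertices to have `N` vertices, the symmetrized graph monomial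
is, for a suitable choice of its sign, non-negative. -/
def NonnegAt (N : ℕ) (G : EdgeGraph d) : Prop :=
  ∃ D : DiMultigraph (Fin G.n), D.IsOrientationOf G.graph ∧
    ∀ x : Fin N → ℝ, 0 ≤ eval x (D.pad N).symMonomial

/-- After appending isolated vertices to have `N` vertices, the symmetrized graph monomial
is, for a suitable choice of its sign, a sum of squares of polynomials. -/
def SosAt (N : ℕ) (G : EdgeGraph d) : Prop :=
  ∃ D : DiMultigraph (Fin G.n), D.IsOrientationOf G.graph ∧ IsSumSq (D.pad N).symMonomial

/-- Non-negativity in the variables attached to the vertices of the graph itself. -/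
def Nonneg (G : EdgeGraph d) : Prop := NonnegAt G.n G

/-- Being a sum of squares in the variables attached to the vertices of the graph itself. -/
def Sos (G : EdgeGraph d) : Prop := SosAt G.n G

end EdgeGraph

/-- The star with four simple edges, directed away from its center. -/
def laxDigraph : DiMultigraph (Fin 5) := .ofList [(0, 1), (0, 2), (0, 3), (0, 4)]

/-- The star with three leaves, one of its edges being doubled, directed away from
its center. -/
def thirdDigraph : DiMultigraph (Fin 4) := .ofList [(0, 1), (0, 1), (0, 2), (0, 3)]

/-- The Lax graph. -/
def laxGraph : EdgeGraph 4 where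
  n := 5
  graph := laxDigraph.toMultigraph
  numEdges_eq := by decide
  noIsolated := by unfold Multigraph.NoIsolated; decide

/-- The star with three leaves, one of its edges being doubled. -/
def thirdGraph : EdgeGraph 4 where
  n := 4
  graph := thirdDigraph.toMultigraph
  numEdges_eq := by decide
  noIsolated := by unfold Multigraph.NoIsolated; decide

end SymGraph

namespace SymGraph

/-! ### Classification of the graphs with four edges -/

/-! Adding edges one at a time to a single edge, and relabelling after each step by tables checked
in the kernel, gives a list of 23 graphs that contains every four-edge graph up to isomorphism
(`exhausts_four`). An invariant built from degrees and multiplicities shows that no two of them are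
isomorphic (`eq_of_repGraph_equiv`).

Expand the product of four differences into signed words of four variables. After symmetrization a
word matters only through which of its letters coincide, that is, through a partition of 4. So each
symmetrized monomial is an integer combination of five orbit sums, with coefficients independent of
`N` (`symEdges_eq_sum`). Vanishing, proportionality and linear relations then follow, for all
admissible `N` at once, from identities between short integer vectors.

Write Q, S, T, L for the symmetrized monomials of the quadruple edge, two disjoint double edges, the
star with one doubled edge, and the Lax star. The comparison gives Q = 2T + S for `N ≥ 4` and 4L =
4T - S for `N ≥ 5`. Evaluation at two 0/1 points shows that T and S are independent, so coordinates
in the basis T, S separate the four classes. Q and S are sums of squares as they stand, and 2T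
becomes one after a rearrangement (`two_mul_mainSym_two_eq_sum`).

L is non-negative because, for sorted variables, the five products with different centers group into
non-negative pieces (`sum_prod_sub_nonneg`). It is not a sum of squares: it vanishes at the 0/1
points with 2, 3 or 5 ones, hence so would the quadratic part of every summand. A linear relation
between values of quadratic forms then makes these parts vanish at a unit vector, where L is
positive (`not_isSumSq_of_eq_or_eq_neg`). -/

/-- The graph with one edge. -/
def oneEdgeReps : List (List (ℕ × ℕ)) := [
  [(0, 1)]]

/-- The graphs with two edges, up to isomorphism. -/
def twoEdgeReps : List (List (ℕ × ℕ)) := [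
  [(0, 1), (0, 1)],
  [(0, 1), (0, 2)],
  [(0, 1), (2, 3)]]

/-- The graphs with three edges, up to isomorphism. -/
def threeEdgeReps : List (List (ℕ × ℕ)) := [
  [(0, 1), (0, 1), (0, 1)],
  [(0, 1), (0, 1), (0, 2)],
  [(0, 1), (0, 1), (2, 3)],
  [(0, 1), (0, 2), (1, 2)],
  [(0, 1), (0, 2), (0, 3)],
  [(0, 1), (0, 2), (1, 3)],
  [(0, 1), (0, 2), (3, 4)],
  [(0, 1), (2, 3), (4, 5)]]

/-- The graphs with four edges, up to isomorphism. -/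
def fourEdgeReps : List (List (ℕ × ℕ)) := [
  [(0, 1), (0, 1), (0, 1), (0, 1)],
  [(0, 1), (0, 1), (0, 1), (0, 2)],
  [(0, 1), (0, 1), (0, 1), (2, 3)],
  [(0, 1), (0, 1), (0, 2), (0, 2)],
  [(0, 1), (0, 1), (0, 2), (1, 2)],
  [(0, 1), (0, 1), (0, 2), (0, 3)],
  [(0, 1), (0, 1), (0, 2), (3, 1)],
  [(0, 1), (0, 1), (0, 2), (3, 2)],
  [(0, 1), (0, 1), (0, 2), (3, 4)],
  [(0, 1), (0, 1), (2, 3), (2, 3)],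
  [(0, 1), (0, 1), (2, 3), (2, 4)],
  [(0, 1), (0, 1), (2, 3), (4, 5)],
  [(0, 1), (0, 2), (0, 3), (1, 2)],
  [(0, 1), (0, 2), (1, 2), (3, 4)],
  [(0, 1), (0, 2), (0, 3), (0, 4)],
  [(0, 1), (0, 2), (0, 3), (4, 1)],
  [(0, 1), (0, 2), (0, 3), (4, 5)],
  [(0, 1), (0, 2), (1, 3), (2, 3)],
  [(0, 1), (0, 2), (1, 3), (2, 4)],
  [(0, 1), (0, 2), (1, 3), (4, 5)],
  [(0, 1), (0, 2), (3, 4), (3, 5)],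
  [(0, 1), (0, 2), (3, 4), (5, 6)],
  [(0, 1), (2, 3), (4, 5), (6, 7)]]

/-- Relabellings for graphs obtained by adding an edge to a graph with one edge: an entry
`(r, a, b, r', p)` says that adding `ab` to the `r`-th graph and relabelling by the product of
the transpositions `p` gives the `r'`-th graph. -/
def twoEdgeTable : List (ℕ × ℕ × ℕ × ℕ × List (ℕ × ℕ)) := [
  (0, 0, 1, 0, []), (0, 0, 2, 1, [(1, 2)]), (0, 1, 2, 1, [(0, 2), (1, 2)]),
  (0, 2, 3, 2, [(0, 2), (1, 3)])]

/-- Relabellings for graphs obtained by adding an edge to a graph with two edges: an entry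
`(r, a, b, r', p)` says that adding `ab` to the `r`-th graph and relabelling by the product of
the transpositions `p` gives the `r'`-th graph. -/
def threeEdgeTable : List (ℕ × ℕ × ℕ × ℕ × List (ℕ × ℕ)) := [
  (0, 0, 1, 0, []), (0, 0, 2, 1, []), (0, 1, 2, 1, [(0, 1)]), (0, 2, 3, 2, []), (1, 0, 1, 1, []),
  (1, 0, 2, 1, [(1, 2)]), (1, 1, 2, 3, [(0, 2), (1, 2)]), (1, 0, 3, 4, [(1, 2), (2, 3)]),
  (1, 1, 3, 5, [(0, 1), (2, 3)]), (1, 2, 3, 5, [(0, 1), (1, 3), (2, 3)]), (1, 3, 4, 6, []),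
  (2, 0, 1, 2, []), (2, 0, 2, 5, [(1, 2)]), (2, 1, 2, 5, [(0, 2), (1, 2)]),
  (2, 0, 3, 5, [(1, 2), (2, 3)]), (2, 1, 3, 5, [(0, 2), (1, 2), (2, 3)]),
  (2, 2, 3, 2, [(0, 2), (1, 3)]), (2, 0, 4, 6, [(1, 2), (2, 3), (3, 4)]),
  (2, 1, 4, 6, [(0, 2), (1, 2), (2, 3), (3, 4)]), (2, 2, 4, 6, [(0, 3), (1, 4), (2, 3)]),
  (2, 3, 4, 6, [(0, 3), (1, 4)]), (2, 4, 5, 7, [(0, 2), (1, 3), (2, 4), (3, 5)])]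

/-- Relabellings for graphs obtained by adding an edge to a graph with three edges: an entry
`(r, a, b, r', p)` says that adding `ab` to the `r`-th graph and relabelling by the product of
the transpositions `p` gives the `r'`-th graph. -/
def fourEdgeTable : List (ℕ × ℕ × ℕ × ℕ × List (ℕ × ℕ)) := [
  (0, 0, 1, 0, []), (0, 0, 2, 1, []), (0, 1, 2, 1, [(0, 1)]), (0, 2, 3, 2, []), (1, 0, 1, 1, []),
  (1, 0, 2, 3, [(1, 2)]), (1, 1, 2, 4, [(0, 1)]), (1, 0, 3, 5, [(2, 3)]),
  (1, 1, 3, 6, [(0, 1), (2, 3)]), (1, 2, 3, 7, []), (1, 3, 4, 8, []), (2, 0, 1, 2, []),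
  (2, 0, 2, 7, []), (2, 1, 2, 7, [(0, 1)]), (2, 0, 3, 7, [(2, 3)]),
  (2, 1, 3, 7, [(0, 1), (2, 3)]), (2, 2, 3, 9, [(0, 2), (1, 3)]), (2, 0, 4, 8, [(2, 3), (3, 4)]),
  (2, 1, 4, 8, [(0, 1), (2, 3), (3, 4)]), (2, 2, 4, 10, [(3, 4)]),
  (2, 3, 4, 10, [(2, 4), (3, 4)]), (2, 4, 5, 11, [(2, 4), (3, 5)]), (3, 0, 1, 4, []),
  (3, 0, 2, 4, [(1, 2)]), (3, 1, 2, 4, [(0, 2), (1, 2)]), (3, 0, 3, 12, []),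
  (3, 1, 3, 12, [(0, 1)]), (3, 2, 3, 12, [(0, 1), (1, 2)]), (3, 3, 4, 13, []), (4, 0, 1, 5, []),
  (4, 0, 2, 5, [(1, 2)]), (4, 1, 2, 12, []), (4, 0, 3, 5, [(1, 2), (2, 3)]),
  (4, 1, 3, 12, [(2, 3)]), (4, 2, 3, 12, [(1, 3), (2, 3)]),
  (4, 0, 4, 14, [(1, 2), (2, 3), (3, 4)]), (4, 1, 4, 15, []), (4, 2, 4, 15, [(1, 2)]),
  (4, 3, 4, 15, [(1, 2), (2, 3)]), (4, 4, 5, 16, []), (5, 0, 1, 6, []), (5, 0, 2, 7, [(1, 2)]),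
  (5, 1, 2, 12, [(0, 2), (1, 2)]), (5, 0, 3, 12, [(1, 2), (2, 3)]),
  (5, 1, 3, 7, [(0, 2), (1, 2), (2, 3)]), (5, 2, 3, 17, [(0, 2), (1, 3)]),
  (5, 0, 4, 15, [(2, 3), (3, 4)]), (5, 1, 4, 15, [(0, 1), (2, 4)]), (5, 2, 4, 18, []),
  (5, 3, 4, 18, [(0, 1), (2, 3)]), (5, 4, 5, 19, []), (6, 0, 1, 8, []), (6, 0, 2, 8, [(1, 2)]),
  (6, 1, 2, 13, [(0, 2), (1, 2)]), (6, 0, 3, 15, [(1, 2), (2, 3)]),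
  (6, 1, 3, 18, [(0, 2), (1, 2), (2, 4), (3, 4)]), (6, 2, 3, 18, [(0, 2), (1, 4), (3, 4)]),
  (6, 0, 4, 15, [(1, 2), (2, 3), (3, 4)]), (6, 1, 4, 18, [(0, 2), (1, 2), (2, 4)]),
  (6, 2, 4, 18, [(0, 2), (1, 4)]), (6, 3, 4, 10, [(0, 2), (1, 3), (2, 4), (3, 4)]),
  (6, 0, 5, 16, [(1, 2), (2, 3), (3, 4), (4, 5)]),
  (6, 1, 5, 19, [(0, 1), (2, 3), (3, 4), (4, 5)]),
  (6, 2, 5, 19, [(0, 1), (1, 3), (2, 3), (3, 4), (4, 5)]),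
  (6, 3, 5, 20, [(0, 3), (1, 4), (2, 5), (4, 5)]),
  (6, 4, 5, 20, [(0, 3), (1, 4), (2, 5), (3, 5), (4, 5)]), (6, 5, 6, 21, [(3, 5), (4, 6)]),
  (7, 0, 1, 11, []), (7, 0, 2, 19, [(1, 2)]), (7, 1, 2, 19, [(0, 2), (1, 2)]),
  (7, 0, 3, 19, [(1, 2), (2, 3)]), (7, 1, 3, 19, [(0, 2), (1, 2), (2, 3)]),
  (7, 2, 3, 11, [(0, 2), (1, 3)]), (7, 0, 4, 19, [(1, 2), (2, 4), (3, 5)]),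
  (7, 1, 4, 19, [(0, 2), (1, 2), (2, 4), (3, 5)]),
  (7, 2, 4, 19, [(0, 4), (1, 5), (2, 4), (3, 4), (4, 5)]),
  (7, 3, 4, 19, [(0, 4), (1, 5), (3, 4), (4, 5)]),
  (7, 0, 5, 19, [(1, 2), (2, 4), (3, 5), (4, 5)]),
  (7, 1, 5, 19, [(0, 2), (1, 2), (2, 4), (3, 5), (4, 5)]),
  (7, 2, 5, 19, [(0, 4), (1, 5), (2, 4), (3, 4)]), (7, 3, 5, 19, [(0, 4), (1, 5), (3, 4)]),
  (7, 4, 5, 11, [(0, 2), (1, 3), (2, 4), (3, 5)]),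
  (7, 0, 6, 21, [(1, 2), (2, 3), (3, 4), (4, 5), (5, 6)]),
  (7, 1, 6, 21, [(0, 2), (1, 2), (2, 3), (3, 4), (4, 5), (5, 6)]),
  (7, 2, 6, 21, [(0, 3), (1, 4), (2, 3), (4, 5), (5, 6)]),
  (7, 3, 6, 21, [(0, 3), (1, 4), (4, 5), (5, 6)]),
  (7, 4, 6, 21, [(0, 3), (1, 4), (2, 5), (3, 6), (4, 6)]),
  (7, 5, 6, 21, [(0, 3), (1, 4), (2, 5), (3, 6), (4, 5), (5, 6)]),
  (7, 6, 7, 22, [(0, 2), (1, 3), (2, 4), (3, 5), (4, 6), (5, 7)])]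

/-- The permutation of `ℕ` which is a product of transpositions. -/
def permOfSwaps (l : List (ℕ × ℕ)) : Equiv.Perm ℕ :=
  (l.map fun p => Equiv.swap p.1 p.2).prod

/-- The undirected edges of a list of directed edges. -/
def undirected (l : List (ℕ × ℕ)) : Multiset (Sym2 ℕ) :=
  (l.map fun e => s(e.1, e.2) : List (Sym2 ℕ))

/-- The least `n` such that all edges join numbers below `n`. -/
def vertexBound (l : List (ℕ × ℕ)) : ℕ :=
  l.foldr (fun e m => max (max e.1 e.2 + 1) m) 0

theorem lt_vertexBound_of_mem {l : List (ℕ × ℕ)} {e : Sym2 ℕ} (he : e ∈ undirected l) {v : ℕ}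
    (hv : v ∈ e) : v < vertexBound l := by
  induction l with
  | nil => simp [undirected] at he
  | cons a l ih =>
    simp only [undirected, List.map_cons, Multiset.mem_coe, List.mem_cons] at he ih
    simp only [vertexBound, List.foldr_cons] at ih ⊢
    rcases he with rfl | he
    · simp only [Sym2.mem_iff] at hv
      rcases hv with rfl | rfl <;> omega
    · exact lt_max_of_lt_right (ih he)

/-- Each entry of the table `T` relabels a graph of the list `A` with an edge added to a graph
of the list `B`. -/
def tableValid (A B : List (List (ℕ × ℕ))) (T : List (ℕ × ℕ × ℕ × ℕ × List (ℕ × ℕ))) : Prop :=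
  ∀ t ∈ T, t.2.2.2.1 < B.length ∧
    (s(t.2.1, t.2.2.1) ::ₘ undirected (A.getD t.1 [])).map (Sym2.map (permOfSwaps t.2.2.2.2)) =
      undirected (B.getD t.2.2.2.1 [])

/-- The table `T` has an entry for every way of adding an edge to a graph of the list `A`. -/
def tableComplete (A : List (List (ℕ × ℕ))) (T : List (ℕ × ℕ × ℕ × ℕ × List (ℕ × ℕ))) : Prop :=
  ∀ r ∈ List.range A.length, ∀ b ∈ List.range (vertexBound (A.getD r []) + 2),
    ∀ a ∈ List.range b,
    (b ≤ vertexBound (A.getD r []) ∨ a = vertexBound (A.getD r [])) →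
      (r, a, b) ∈ T.map fun t => (t.1, t.2.1, t.2.2.1)

instance (A B : List (List (ℕ × ℕ))) (T : List (ℕ × ℕ × ℕ × ℕ × List (ℕ × ℕ))) :
    Decidable (tableValid A B T) := by
  unfold tableValid; infer_instance

instance (A : List (List (ℕ × ℕ))) (T : List (ℕ × ℕ × ℕ × ℕ × List (ℕ × ℕ))) :
    Decidable (tableComplete A T) := by
  unfold tableComplete; infer_instance

/-- Every graph of the list `A` becomes, after adding an edge and relabelling, a graph of the
list `B`, as witnessed by the table `T`. -/
def tableCovers (A B : List (List (ℕ × ℕ))) (T : List (ℕ × ℕ × ℕ × ℕ × List (ℕ × ℕ))) : Prop :=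
  tableValid A B T ∧ tableComplete A T

theorem tableCovers_two : tableCovers oneEdgeReps twoEdgeReps twoEdgeTable :=
  ⟨by decide +kernel, by decide +kernel⟩

theorem tableCovers_three : tableCovers twoEdgeReps threeEdgeReps threeEdgeTable :=
  ⟨by decide +kernel, by decide +kernel⟩

theorem tableCovers_four : tableCovers threeEdgeReps fourEdgeReps fourEdgeTable :=
  ⟨by decide +kernel, by decide +kernel⟩

/-- Up to relabelling, every loopless multiset of `k` edges is in the list `A`. -/
def Exhausts (k : ℕ) (A : List (List (ℕ × ℕ))) : Prop :=
  ∀ m : Multiset (Sym2 ℕ), m.card = k → (∀ e ∈ m, ¬ e.IsDiag) →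
    ∃ r < A.length, ∃ f : Equiv.Perm ℕ, m.map (Sym2.map f) = undirected (A.getD r [])

/-- Labels at or above `v` are unused, so they can be permuted freely: unused endpoints of the new
edge are moved to `v` and, if both are unused, to `v + 1`. This leaves exactly the finitely many
cases listed in `tableComplete`. -/
theorem exists_perm_normalize_pair (v a b : ℕ) (hab : a ≠ b) :
    ∃ g : Equiv.Perm ℕ, (∀ w < v, g w = w) ∧ ∃ a' b', a' < b' ∧
      Sym2.map g s(a, b) = s(a', b') ∧ (b' ≤ v ∨ a' = v ∧ b' = v + 1) := by
  wlog h : a < b generalizing a b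
  · obtain ⟨g, hg, a', b', h1, h2, h3⟩ := this b a hab.symm (by omega)
    exact ⟨g, hg, a', b', h1, by rw [Sym2.eq_swap, h2], h3⟩
  by_cases hb : b < v
  · exact ⟨1, fun _ _ => rfl, a, b, h, rfl, Or.inl hb.le⟩
  by_cases ha : a < v
  · refine ⟨Equiv.swap b v, fun w hw => Equiv.swap_apply_of_ne_of_ne (by omega) (by omega),
      a, v, ha, ?_, Or.inl le_rfl⟩
    rw [Sym2.map_mk, Equiv.swap_apply_left, Equiv.swap_apply_of_ne_of_ne (by omega) (by omega)]
  · refine ⟨Equiv.swap b (v + 1) * Equiv.swap a v, fun w hw => ?_, v, v + 1, by omega, ?_,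
      Or.inr ⟨rfl, rfl⟩⟩
    · rw [Equiv.Perm.mul_apply, Equiv.swap_apply_of_ne_of_ne (a := a) (by omega) (by omega),
        Equiv.swap_apply_of_ne_of_ne (by omega) (by omega)]
    · rw [Sym2.map_mk, Equiv.Perm.mul_apply, Equiv.Perm.mul_apply, Equiv.swap_apply_left,
        Equiv.swap_apply_of_ne_of_ne (a := a) (b := v) (x := b) (by omega) (by omega),
        Equiv.swap_apply_left, Equiv.swap_apply_of_ne_of_ne (by omega) (by omega)]

/-- Remove one edge, bring the rest into the list by `hA`, then normalize the removed edge without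
disturbing the labels in use. The table supplies the last relabelling. -/
theorem Exhausts.succ {k : ℕ} {A B : List (List (ℕ × ℕ))}
    {T : List (ℕ × ℕ × ℕ × ℕ × List (ℕ × ℕ))} (hT : tableCovers A B T) (hA : Exhausts k A) :
    Exhausts (k + 1) B := by
  intro m hm hd
  obtain ⟨e, m, rfl⟩ : ∃ e m', m = e ::ₘ m' :=
    ⟨_, Multiset.exists_cons_of_mem
      (Multiset.card_pos_iff_exists_mem.1 (by omega : 0 < m.card)).choose_spec⟩
  obtain ⟨r, hr, f, hf⟩ := hA m (by simpa using hm) fun e he => hd e (Multiset.mem_cons_of_mem he)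
  have he : ¬ (Sym2.map f e).IsDiag := by
    rw [Sym2.isDiag_map f.injective]
    exact hd e (Multiset.mem_cons_self _ _)
  generalize hfe : Sym2.map f e = e' at he
  induction e' with | _ a b
  obtain ⟨g, hg, a', b', hlt, hmap, hcase⟩ :=
    exists_perm_normalize_pair (vertexBound (A.getD r [])) a b (by simpa using he)
  obtain ⟨t, ht, hteq⟩ := List.mem_map.1 (hT.2 r (List.mem_range.2 hr) b'
    (List.mem_range.2 (by omega)) a' (List.mem_range.2 hlt) (by omega))
  obtain ⟨rfl, rfl, rfl⟩ : t.1 = r ∧ t.2.1 = a' ∧ t.2.2.1 = b' := by simpa using hteq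
  refine ⟨_, (hT.1 t ht).1, (f.trans g).trans (permOfSwaps t.2.2.2.2), ?_⟩
  rw [← (hT.1 t ht).2, ← hmap, ← hfe]
  have hfix : (undirected (A.getD t.1 [])).map (Sym2.map g) = undirected (A.getD t.1 []) := by
    refine (Multiset.map_congr rfl fun x hx => ?_).trans (Multiset.map_id' _)
    exact (Sym2.map_congr fun v hv => hg v (lt_vertexBound_of_mem hx hv)).trans
      (congrFun Sym2.map_id x)
  rw [← hfix, ← hf]
  simp [Multiset.map_map, Sym2.map_map, Function.comp_def]

theorem exhausts_one : Exhausts 1 oneEdgeReps := by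
  intro m hm hd
  obtain ⟨e, rfl⟩ := Multiset.card_eq_one.1 hm
  have he := hd e (by simp)
  induction e with | _ a b
  obtain ⟨g, -, a', b', hlt, hmap, hcase⟩ := exists_perm_normalize_pair 0 a b (by simpa using he)
  refine ⟨0, by decide, g, ?_⟩
  obtain ⟨rfl, rfl⟩ : a' = 0 ∧ b' = 1 := by omega
  rw [Multiset.map_singleton, hmap]
  rfl

theorem exhausts_four : Exhausts 4 fourEdgeReps :=
  ((exhausts_one.succ tableCovers_two).succ tableCovers_three).succ tableCovers_four

/-! ### The listed edge sets as graphs on `Fin n` -/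

/-- The directed graph on `n` vertices with the given list of edges (loops and edges with a vertex
outside of the range are dropped). -/
def digraphOfEdges (n : ℕ) (l : List (ℕ × ℕ)) : DiMultigraph (Fin n) where
  adj i j := if i = j then 0 else l.count (i.1, j.1)
  loopless i := by simp

theorem mult_digraphOfEdges {n : ℕ} {l : List (ℕ × ℕ)} (hl : ∀ e ∈ l, e.1 ≠ e.2) (u v : Fin n) :
    (digraphOfEdges n l).toMultigraph.mult s(u, v) = (undirected l).count s(u.1, v.1) := by
  by_cases huv : u = v
  · subst huv
    rw [Multigraph.loopless, eq_comm, Multiset.count_eq_zero]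
    intro h
    obtain ⟨e, he, heq⟩ := List.mem_map.1 (Multiset.mem_coe.1 h)
    simp only [Sym2.eq_iff] at heq
    exact hl e he (by omega)
  · change (if u = v then 0 else l.count (u.1, v.1)) + (if v = u then 0 else l.count (v.1, u.1)) = _
    rw [if_neg huv, if_neg (Ne.symm huv), undirected, Multiset.coe_count]
    have huv' : u.1 ≠ v.1 := fun h => huv (Fin.ext h)
    clear hl
    induction l with
    | nil => rfl
    | cons e l ih =>
      obtain ⟨a, b⟩ := e
      simp only [List.map_cons, List.count_cons, ← ih, beq_iff_eq, Prod.mk.injEq, Sym2.eq_iff]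
      split_ifs <;> omega

/-- The edges of the `i`-th graph with four edges. -/
def repEdges (i : Fin 23) : List (ℕ × ℕ) := fourEdgeReps.getD i.1 []

/-- The number of vertices of the `i`-th graph with four edges. -/
def repSize (i : Fin 23) : ℕ := vertexBound (repEdges i)

/-- The `i`-th graph with four edges, as a directed graph. -/
def repDigraph (i : Fin 23) : DiMultigraph (Fin (repSize i)) :=
  digraphOfEdges (repSize i) (repEdges i)

theorem repEdges_fst_ne_snd : ∀ i, ∀ e ∈ repEdges i, e.1 ≠ e.2 := by decide +kernel

theorem exists_mem_repEdges : ∀ i, ∀ v ∈ List.range (repSize i),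
    ∃ e ∈ repEdges i, v = e.1 ∨ v = e.2 := by
  decide +kernel

theorem repDigraph_numEdges : ∀ i, (repDigraph i).toMultigraph.numEdges = 4 := by decide +kernel

theorem exists_mem_undirected (i : Fin 23) {v : ℕ} (hv : v < repSize i) :
    ∃ w, w < repSize i ∧ s(v, w) ∈ undirected (repEdges i) := by
  obtain ⟨e, he, hve⟩ := exists_mem_repEdges i v (List.mem_range.2 hv)
  have hmem : s(e.1, e.2) ∈ undirected (repEdges i) :=
    Multiset.mem_coe.2 (List.mem_map.2 ⟨e, he, rfl⟩)
  rcases hve with rfl | rfl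
  · exact ⟨e.2, lt_vertexBound_of_mem hmem (by simp), hmem⟩
  · exact ⟨e.1, lt_vertexBound_of_mem hmem (by simp), by rwa [Sym2.eq_swap]⟩

/-- The `i`-th graph with four edges. -/
def repGraph (i : Fin 23) : EdgeGraph 4 where
  n := repSize i
  graph := (repDigraph i).toMultigraph
  numEdges_eq := repDigraph_numEdges i
  noIsolated v := by
    obtain ⟨w, hw, hmem⟩ := exists_mem_undirected i v.2
    refine ⟨⟨w, hw⟩, ?_⟩
    rw [repDigraph, mult_digraphOfEdges (repEdges_fst_ne_snd i)]
    exact (Multiset.count_pos.2 hmem).ne'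

/-- The edges of a graph on `Fin n` as a multiset of unordered pairs of natural numbers. -/
def Multigraph.edgeMultiset {n : ℕ} (G : Multigraph (Fin n)) : Multiset (Sym2 ℕ) :=
  ∑ e : Sym2 (Fin n), G.mult e • {e.map Fin.val}

theorem Multigraph.card_edgeMultiset {n : ℕ} (G : Multigraph (Fin n)) :
    G.edgeMultiset.card = G.numEdges := by
  simp [Multigraph.edgeMultiset, Multigraph.numEdges]

theorem Multigraph.count_edgeMultiset {n : ℕ} (G : Multigraph (Fin n)) (e : Sym2 (Fin n)) :
    G.edgeMultiset.count (e.map Fin.val) = G.mult e := by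
  rw [Multigraph.edgeMultiset, Multiset.count_sum', Finset.sum_eq_single e]
  · simp
  · intro b _ hb
    have : e.map Fin.val ≠ b.map Fin.val :=
      fun h => hb (Sym2.map.injective Fin.val_injective h).symm
    simp [this]
  · simp

theorem Multigraph.exists_of_mem_edgeMultiset {n : ℕ} {G : Multigraph (Fin n)} {e : Sym2 ℕ}
    (he : e ∈ G.edgeMultiset) : ∃ e' : Sym2 (Fin n), G.mult e' ≠ 0 ∧ e'.map Fin.val = e := by
  obtain ⟨e', -, he'⟩ := Multiset.mem_sum.1 he
  refine ⟨e', ?_, ?_⟩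
  · rintro h
    simp [h] at he'
  · exact (Multiset.mem_singleton.1 (Multiset.mem_of_mem_nsmul he')).symm

/-- The classification gives a permutation of all natural numbers matching the edge multisets. As
neither graph has isolated vertices, the vertices are exactly the endpoints of edges, so the
permutation restricts to a bijection of the vertex sets. -/
theorem exists_equiv_repGraph (G : EdgeGraph 4) : ∃ i, G ≈ repGraph i := by
  have hdiag : ∀ e ∈ G.graph.edgeMultiset, ¬ e.IsDiag := by
    intro e he hd
    obtain ⟨e', he', rfl⟩ := Multigraph.exists_of_mem_edgeMultiset he
    induction e' with | _ a b
    obtain rfl : a = b := Fin.ext (by simpa using hd)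
    exact he' (G.graph.loopless a)
  obtain ⟨r, hr, f, hf⟩ := exhausts_four _
    (G.graph.card_edgeMultiset.trans G.numEdges_eq) hdiag
  obtain ⟨i, rfl⟩ : ∃ i : Fin 23, i.1 = r := ⟨⟨r, hr⟩, rfl⟩
  change _ = undirected (repEdges i) at hf
  have h1 : ∀ u : Fin G.n, f u.1 < repSize i := by
    intro u
    obtain ⟨w, hw⟩ := G.noIsolated u
    have : s(f u.1, f w.1) ∈ undirected (repEdges i) := by
      rw [← hf]
      refine Multiset.mem_map.2 ⟨s(u.1, w.1), ?_, rfl⟩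
      rw [← G.graph.count_edgeMultiset, ← Nat.pos_iff_ne_zero] at hw
      exact Multiset.count_pos.1 hw
    exact lt_vertexBound_of_mem this (by simp)
  have h2 : ∀ v : Fin (repSize i), f.symm v.1 < G.n := by
    intro v
    obtain ⟨w, -, hw⟩ := exists_mem_undirected i v.2
    rw [← hf] at hw
    obtain ⟨e, he, hew⟩ := Multiset.mem_map.1 hw
    obtain ⟨e', -, rfl⟩ := Multigraph.exists_of_mem_edgeMultiset he
    have hv : v.1 ∈ Sym2.map f (Sym2.map Fin.val e') := by rw [hew]; simp
    simp only [Sym2.mem_map] at hv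
    obtain ⟨_, ⟨a, -, rfl⟩, ha⟩ := hv
    rw [← ha, Equiv.symm_apply_apply]
    exact a.2
  let φ : Fin G.n ≃ Fin (repSize i) := ⟨fun u => ⟨f u.1, h1 u⟩, fun v => ⟨f.symm v.1, h2 v⟩,
    fun u => by simp, fun v => by simp⟩
  refine ⟨i, φ, fun u v => ?_⟩
  refine (mult_digraphOfEdges (repEdges_fst_ne_snd i) (φ u) (φ v)).trans ?_
  rw [← hf, ← G.graph.count_edgeMultiset]
  exact Multiset.count_map_eq_count' (Sym2.map f) _ (Sym2.map.injective f.injective) s(u.1, v.1)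

/-! ### Pairwise non-isomorphism and counting of classes -/

/-- A numerical invariant of graphs, computed from the degrees and the multiplicities. -/
def Multigraph.invariant {V : Type} [Fintype V] (G : Multigraph V) : ℕ :=
  ∑ u, ∑ v, G.mult s(u, v) * (G.mult s(u, v) + ∑ w, G.mult s(u, w)) ^ 2 *
    (G.mult s(u, v) + ∑ w, G.mult s(v, w))

theorem Multigraph.Iso.invariant_eq {V W : Type} [Fintype V] [Fintype W] {G : Multigraph V}
    {H : Multigraph W} (h : G.Iso H) : G.invariant = H.invariant := by
  obtain ⟨f, hf⟩ := h
  simp only [Multigraph.invariant, ← Equiv.sum_comp f, hf]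

theorem repDigraph_invariant_injective :
    ∀ i j, (repDigraph i).toMultigraph.invariant = (repDigraph j).toMultigraph.invariant →
      i = j := by
  decide +kernel

theorem eq_of_repGraph_equiv {i j : Fin 23} (h : repGraph i ≈ repGraph j) : i = j :=
  repDigraph_invariant_injective i j (Multigraph.Iso.invariant_eq h)

/-- The set of graphs which are isomorphic to one of the given representatives. -/
def repClass (A : Finset (Fin 23)) : Set (EdgeGraph 4) := {G | ∃ i ∈ A, G ≈ repGraph i}

theorem isoCount_repClass (A : Finset (Fin 23)) : EdgeGraph.isoCount (repClass A) = A.card := by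
  have : Quotient.mk (EdgeGraph.isoSetoid 4) '' repClass A =
      (fun i => Quotient.mk (EdgeGraph.isoSetoid 4) (repGraph i)) '' (A : Set (Fin 23)) := by
    ext q
    constructor
    · rintro ⟨G, ⟨i, hi, h⟩, rfl⟩
      exact ⟨i, hi, (Quotient.sound h).symm⟩
    · rintro ⟨i, hi, rfl⟩
      exact ⟨repGraph i, ⟨i, hi, Setoid.refl _⟩, rfl⟩
  rw [EdgeGraph.isoCount, this, Set.ncard_image_of_injective, Set.ncard_coe_finset]
  exact fun i j h => eq_of_repGraph_equiv (Quotient.exact h)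

theorem repClass_univ : repClass Finset.univ = Set.univ :=
  Set.eq_univ_of_forall fun G =>
    let ⟨i, hi⟩ := exists_equiv_repGraph G
    ⟨i, Finset.mem_univ i, hi⟩

/-! ### Symmetrized graph monomials -/

theorem exists_perm_comp_eq {α β : Type*} [Finite β] (f g : α ↪ β) :
    ∃ π : Equiv.Perm β, ∀ a, π (f a) = g a := by
  classical
  obtain ⟨_⟩ := nonempty_fintype β
  let e : {b // b ∈ Set.range f} ≃ {b // b ∈ Set.range g} :=
    (Equiv.ofInjective f f.injective).symm.trans (Equiv.ofInjective g g.injective)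
  refine ⟨e.extendSubtype, fun a => ?_⟩
  rw [Equiv.extendSubtype_apply_of_mem e (f a) ⟨a, rfl⟩]
  simp [e, Equiv.ofInjective_symm_apply]

/-- Two embeddings into a finite type differ by a permutation of the target, which reindexing the
sum absorbs. This is why symmetrizations ignore the labelling of vertices and the position of the
isolated ones. -/
theorem sum_perm_comp_embedding {α β M : Type*} [Fintype β] [DecidableEq β] [AddCommMonoid M]
    (f g : α ↪ β) (F : (α → β) → M) :
    ∑ σ : Equiv.Perm β, F (σ ∘ f) = ∑ σ : Equiv.Perm β, F (σ ∘ g) := by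
  obtain ⟨π, hπ⟩ := exists_perm_comp_eq f g
  rw [← Equiv.sum_comp (Equiv.mulRight π)]
  refine Finset.sum_congr rfl fun σ _ => congrArg F (funext fun a => ?_)
  simp [hπ]

namespace DiMultigraph

theorem pad_graphMonomial {n N : ℕ} (h : n ≤ N) (D : DiMultigraph (Fin n)) :
    (D.pad N).graphMonomial = rename (Fin.castLE h) D.graphMonomial := by
  have hout : ∀ i : Fin N, i ∉ Set.range (Fin.castLE h) → ¬ i.1 < n := fun i hi hlt =>
    hi ⟨⟨i.1, hlt⟩, rfl⟩
  simp only [graphMonomial, map_prod, map_pow, map_sub, rename_X]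
  refine (Fintype.prod_of_injective (Fin.castLE h) (Fin.castLE_injective h) _ _ ?_ ?_).symm
  · intro i hi
    refine Finset.prod_eq_one fun j _ => ?_
    have := hout i hi
    simp [pad, this]
  · intro i
    refine Fintype.prod_of_injective (Fin.castLE h) (Fin.castLE_injective h) _ _ ?_ ?_
    · intro j hj
      have := hout j hj
      simp [pad, this]
    · intro j
      simp [pad]

theorem pad_symMonomial {n N : ℕ} (h : n ≤ N) (D : DiMultigraph (Fin n)) :
    (D.pad N).symMonomial =
      ∑ σ : Equiv.Perm (Fin N), rename (σ ∘ Fin.castLE h) D.graphMonomial := by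
  simp only [symMonomial, pad_graphMonomial h, rename_rename]

/-- Transport of a directed graph along a bijection. -/
def comap {V W : Type} (f : V ≃ W) (D : DiMultigraph W) : DiMultigraph V where
  adj u v := D.adj (f u) (f v)
  loopless v := D.loopless (f v)

theorem rename_graphMonomial_comap {V W : Type} [Fintype V] [Fintype W] (f : V ≃ W)
    (D : DiMultigraph W) : rename f (D.comap f).graphMonomial = D.graphMonomial := by
  simp only [graphMonomial, comap, map_prod, map_pow, map_sub, rename_X, ← Equiv.prod_comp f]

theorem pad_symMonomial_comap {n m N : ℕ} (hn : n ≤ N) (hm : m ≤ N) (f : Fin n ≃ Fin m)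
    (D : DiMultigraph (Fin m)) :
    ((D.comap f).pad N).symMonomial = (D.pad N).symMonomial := by
  rw [pad_symMonomial hn, pad_symMonomial hm, ← rename_graphMonomial_comap f D]
  simp only [rename_rename, Function.comp_assoc]
  exact sum_perm_comp_embedding (Fin.castLEEmb hn) (f.toEmbedding.trans (Fin.castLEEmb hm))
    fun g => rename g (D.comap f).graphMonomial

theorem comap_isOrientationOf {V W : Type} {G : Multigraph V} {H : Multigraph W} {f : V ≃ W}
    (hf : ∀ u v, H.mult s(f u, f v) = G.mult s(u, v)) {D : DiMultigraph W}
    (hD : D.IsOrientationOf H) : (D.comap f).IsOrientationOf G := by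
  obtain rfl : D.toMultigraph = H := hD
  obtain ⟨m, hm⟩ := G
  simp only [IsOrientationOf, toMultigraph, Multigraph.mk.injEq]
  funext e
  induction e with | _ u v
  exact hf u v

/-- The fourth power of a value depends only on the undirected multiplicities. Squares of real
values are non-negative, so the squares of the two polynomials agree at every point, and in a domain
this determines the polynomial up to sign. -/
theorem graphMonomial_eq_or_eq_neg {V : Type} [Fintype V] {D E : DiMultigraph V}
    (h : D.toMultigraph = E.toMultigraph) :
    D.graphMonomial = E.graphMonomial ∨ D.graphMonomial = -E.graphMonomial := by
  have key : ∀ (F : DiMultigraph V) (x : V → ℝ), (eval x F.graphMonomial ^ 2) ^ 2 =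
      ∏ i, ∏ j, ((x i - x j) ^ 2) ^ F.toMultigraph.mult s(i, j) := by
    intro F x
    have h1 : eval x F.graphMonomial ^ 2 = ∏ i, ∏ j, ((x i - x j) ^ 2) ^ F.adj i j := by
      simp only [graphMonomial, map_prod, map_pow, map_sub, eval_X, ← Finset.prod_pow]
      refine Finset.prod_congr rfl fun i _ => Finset.prod_congr rfl fun j _ => ?_
      rw [← pow_mul, ← pow_mul, mul_comm]
    have h2 : eval x F.graphMonomial ^ 2 = ∏ i, ∏ j, ((x i - x j) ^ 2) ^ F.adj j i := by
      rw [h1, Finset.prod_comm]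
      refine Finset.prod_congr rfl fun i _ => Finset.prod_congr rfl fun j _ => ?_
      rw [← neg_sub, neg_sq]
    rw [pow_two]
    nth_rw 1 [h1]
    -- One copy of the square is written with `adj i j` and the other with `adj j i`, so that the
    -- exponents add up to the undirected multiplicity.
    rw [h2, ← Finset.prod_mul_distrib]
    refine Finset.prod_congr rfl fun i _ => ?_
    rw [← Finset.prod_mul_distrib]
    refine Finset.prod_congr rfl fun j _ => ?_
    rw [← pow_add]
    rfl
  refine sq_eq_sq_iff_eq_or_eq_neg.1 (MvPolynomial.funext fun x => ?_)
  have := (key D x).trans ((congrArg (fun G : Multigraph V =>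
    ∏ i, ∏ j, ((x i - x j) ^ 2) ^ G.mult s(i, j)) h).trans (key E x).symm)
  simpa using (sq_eq_sq₀ (sq_nonneg _) (sq_nonneg _)).1 this

theorem pad_symMonomial_eq_or_eq_neg {n N : ℕ} (hn : n ≤ N) {D E : DiMultigraph (Fin n)}
    (h : D.toMultigraph = E.toMultigraph) :
    (D.pad N).symMonomial = (E.pad N).symMonomial ∨
      (D.pad N).symMonomial = -(E.pad N).symMonomial := by
  rw [pad_symMonomial hn, pad_symMonomial hn]
  rcases graphMonomial_eq_or_eq_neg h with h | h
  · exact Or.inl (by rw [h])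
  · exact Or.inr (by simp [h])

end DiMultigraph

/-- The variable to which a permutation of the `N` variables sends the variable with the given
index, and zero if the index is out of range. -/
noncomputable def permVar {N : ℕ} (σ : Equiv.Perm (Fin N)) (a : ℕ) : MvPolynomial (Fin N) ℝ :=
  if h : a < N then X (σ ⟨a, h⟩) else 0

/-- The symmetrization in `N` variables of the product of the differences of the variables
along a list of edges. -/
noncomputable def symEdges (N : ℕ) (l : List (ℕ × ℕ)) : MvPolynomial (Fin N) ℝ :=
  ∑ σ : Equiv.Perm (Fin N), (l.map fun e => permVar σ e.1 - permVar σ e.2).prod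

theorem graphMonomial_digraphOfEdges {n : ℕ} {l : List (ℕ × ℕ)} (hl : ∀ e ∈ l, e.1 ≠ e.2)
    (hn : ∀ e ∈ l, e.1 < n ∧ e.2 < n) :
    (digraphOfEdges n l).graphMonomial =
      (l.map fun e => permVar (1 : Equiv.Perm (Fin n)) e.1 - permVar 1 e.2).prod := by
  have h1 : (digraphOfEdges n l).graphMonomial =
      ∏ p : Fin n × Fin n, (X p.1 - X p.2) ^ (l.count (p.1.1, p.2.1)) := by
    rw [DiMultigraph.graphMonomial, ← Finset.univ_product_univ, Finset.prod_product]
    refine Finset.prod_congr rfl fun i _ => Finset.prod_congr rfl fun j _ => ?_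
    by_cases hij : i = j
    · subst hij
      have : l.count (i.1, i.1) = 0 := List.count_eq_zero.2 fun h => hl _ h rfl
      simp [digraphOfEdges, this]
    · simp [digraphOfEdges, hij]
  have hcount : ∀ e, @List.count _ instBEqOfDecidableEq e l = l.count e := fun e => by
    congr
    exact lawful_beq_subsingleton _ _
  rw [h1, Finset.prod_list_map_count]
  refine (Finset.prod_subset_one_on_sdiff (s₁ := l.toFinset)
    (s₂ := Finset.univ.image fun p : Fin n × Fin n => (p.1.1, p.2.1)) ?_ ?_
    (fun _ _ => rfl) |>.trans ?_).symm
  · intro e he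
    obtain ⟨h, h'⟩ := hn e (List.mem_toFinset.1 he)
    exact Finset.mem_image.2 ⟨(⟨e.1, h⟩, ⟨e.2, h'⟩), Finset.mem_univ _, rfl⟩
  · intro e he
    rw [hcount, List.count_eq_zero.2 fun h => (Finset.mem_sdiff.1 he).2 (List.mem_toFinset.2 h),
      pow_zero]
  · rw [Finset.prod_image]
    · refine Finset.prod_congr rfl fun p _ => ?_
      simp only [hcount, permVar, Fin.is_lt, dif_pos, Equiv.Perm.one_apply]
    · rintro ⟨a, b⟩ - ⟨c, d⟩ - h
      simpa [Fin.ext_iff] using h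

theorem pad_symMonomial_digraphOfEdges {n N : ℕ} (hN : n ≤ N) {l : List (ℕ × ℕ)}
    (hl : ∀ e ∈ l, e.1 ≠ e.2) (hn : ∀ e ∈ l, e.1 < n ∧ e.2 < n) :
    ((digraphOfEdges n l).pad N).symMonomial = symEdges N l := by
  rw [DiMultigraph.pad_symMonomial hN, symEdges]
  refine Finset.sum_congr rfl fun σ _ => ?_
  rw [graphMonomial_digraphOfEdges hl hn, map_list_prod, List.map_map]
  congr 1
  refine List.map_congr_left fun e he => ?_
  obtain ⟨h, h'⟩ := hn e he
  simp [permVar, h, h', h.trans_le hN, h'.trans_le hN]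

/-! ### Expansion into words -/

/-- The symmetrization in `N` variables of the product of four variables. -/
noncomputable def wordSum (N a b c d : ℕ) : MvPolynomial (Fin N) ℝ :=
  ∑ σ : Equiv.Perm (Fin N), permVar σ a * permVar σ b * permVar σ c * permVar σ d

/-- The number of pairs of equal letters in a word of length four. -/
def equalPairs (a b c d : ℕ) : ℕ :=
  (if a = b then 1 else 0) + (if a = c then 1 else 0) + (if a = d then 1 else 0) +
    (if b = c then 1 else 0) + (if b = d then 1 else 0) + (if c = d then 1 else 0)

/-- The symmetrization of a word of length four with `t` pairs of equal letters. -/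
noncomputable def typeSum (N t : ℕ) : MvPolynomial (Fin N) ℝ :=
  match t with
  | 0 => wordSum N 0 1 2 3
  | 1 => wordSum N 0 0 1 2
  | 2 => wordSum N 0 0 1 1
  | 3 => wordSum N 0 0 0 1
  | 6 => wordSum N 0 0 0 0
  | _ => 0

theorem wordSum_comp {N k : ℕ} (w : Fin k → ℕ) (hw : Function.Injective w) (hN : ∀ i, w i < N)
    (a b c d : Fin k) : wordSum N (w a) (w b) (w c) (w d) = wordSum N a b c d := by
  have hk : k ≤ N := by
    simpa using Fintype.card_le_of_injective (fun i => (⟨w i, hN i⟩ : Fin N))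
      fun i j h => hw (by simpa using h)
  have := sum_perm_comp_embedding (⟨fun i => ⟨w i, hN i⟩, fun i j h => hw (by simpa using h)⟩ :
    Fin k ↪ Fin N) (Fin.castLEEmb hk)
    fun g => (X (g a) * X (g b) * X (g c) * X (g d) : MvPolynomial (Fin N) ℝ)
  have hlt : ∀ i : Fin k, i.1 < N := fun i => i.2.trans_le hk
  simp only [wordSum, permVar, hN, hlt, dif_pos]
  exact this

/-- The number of equal pairs separates the partitions of 4: the types 1111, 211, 22, 31, 4 have 0,
1, 2, 3, 6 of them. The values 4 and 5 never occur, so the default value of `typeSum` is harmless.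
In each case adjacent swaps of commuting factors sort the word, and an injective renaming of letters
makes it standard. -/
theorem wordSum_eq_typeSum {N a b c d : ℕ} (ha : a < N) (hb : b < N) (hc : c < N) (hd : d < N) :
    wordSum N a b c d = typeSum N (equalPairs a b c d) := by
  have s1 : ∀ a b c d, wordSum N a b c d = wordSum N b a c d := fun a b c d =>
    Finset.sum_congr rfl fun σ _ => by ring
  have s2 : ∀ a b c d, wordSum N a b c d = wordSum N a c b d := fun a b c d =>
    Finset.sum_congr rfl fun σ _ => by ring
  have s3 : ∀ a b c d, wordSum N a b c d = wordSum N a b d c := fun a b c d =>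
    Finset.sum_congr rfl fun σ _ => by ring
  have h6 : ∀ a < N, wordSum N a a a a = wordSum N 0 0 0 0 := fun a ha =>
    wordSum_comp ![a] (Function.injective_of_subsingleton _) (by simpa using ha) 0 0 0 0
  have h3 : ∀ a < N, ∀ b < N, a ≠ b → wordSum N a a a b = wordSum N 0 0 0 1 :=
    fun a ha b hb hab => wordSum_comp ![a, b]
      (by intro i j; fin_cases i <;> fin_cases j <;> simp <;> omega)
      (by intro i; fin_cases i <;> assumption) 0 0 0 1
  have h2 : ∀ a < N, ∀ b < N, a ≠ b → wordSum N a a b b = wordSum N 0 0 1 1 :=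
    fun a ha b hb hab => wordSum_comp ![a, b]
      (by intro i j; fin_cases i <;> fin_cases j <;> simp <;> omega)
      (by intro i; fin_cases i <;> assumption) 0 0 1 1
  have h1 : ∀ a < N, ∀ b < N, ∀ c < N, a ≠ b → a ≠ c → b ≠ c →
      wordSum N a a b c = wordSum N 0 0 1 2 :=
    fun a ha b hb c hc hab hac hbc => wordSum_comp ![a, b, c]
      (by intro i j; fin_cases i <;> fin_cases j <;> simp <;> omega)
      (by intro i; fin_cases i <;> assumption) 0 0 1 2
  have h0 : a ≠ b → a ≠ c → a ≠ d → b ≠ c → b ≠ d → c ≠ d →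
      wordSum N a b c d = wordSum N 0 1 2 3 :=
    fun hab hac had hbc hbd hcd => wordSum_comp ![a, b, c, d]
      (by intro i j; fin_cases i <;> fin_cases j <;> simp <;> omega)
      (by intro i; fin_cases i <;> assumption) 0 1 2 3
  rcases eq_or_ne a b with rfl | hab
  · rcases eq_or_ne a c with rfl | hac
    · rcases eq_or_ne a d with rfl | had
      · have : equalPairs a a a a = 6 := by grind [equalPairs]
        rw [this]
        exact h6 a ha
      · have : equalPairs a a a d = 3 := by grind [equalPairs]
        rw [this]
        exact h3 a ha d hd had
    · rcases eq_or_ne a d with rfl | had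
      · have : equalPairs a a c a = 3 := by grind [equalPairs]
        rw [this, s3 a a c a]
        exact h3 a ha c hc hac
      · rcases eq_or_ne c d with rfl | hcd
        · have : equalPairs a a c c = 2 := by grind [equalPairs]
          rw [this]
          exact h2 a ha c hc hac
        · have : equalPairs a a c d = 1 := by grind [equalPairs]
          rw [this]
          exact h1 a ha c hc d hd hac had hcd
  · rcases eq_or_ne a c with rfl | hac
    · rcases eq_or_ne a d with rfl | had
      · have : equalPairs a b a a = 3 := by grind [equalPairs]
        rw [this, s2 a b a a, s3 a a b a]
        exact h3 a ha b hb hab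
      · rcases eq_or_ne b d with rfl | hbd
        · have : equalPairs a b a b = 2 := by grind [equalPairs]
          rw [this, s2 a b a b]
          exact h2 a ha b hb hab
        · have : equalPairs a b a d = 1 := by grind [equalPairs]
          rw [this, s2 a b a d]
          exact h1 a ha b hb d hd hab had hbd
    · rcases eq_or_ne b c with rfl | hbc
      · rcases eq_or_ne a d with rfl | had
        · have : equalPairs a b b a = 2 := by grind [equalPairs]
          rw [this, s1 a b b a, s2 b a b a]
          exact h2 b hb a ha hab.symm
        · rcases eq_or_ne b d with rfl | hbd
          · have : equalPairs a b b b = 3 := by grind [equalPairs]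
            rw [this, s1 a b b b, s2 b a b b, s3 b b a b]
            exact h3 b hb a ha hab.symm
          · have : equalPairs a b b d = 1 := by grind [equalPairs]
            rw [this, s1 a b b d, s2 b a b d]
            exact h1 b hb a ha d hd hab.symm hbd had
      · rcases eq_or_ne a d with rfl | had
        · have : equalPairs a b c a = 1 := by grind [equalPairs]
          rw [this, s3 a b c a, s2 a b a c]
          exact h1 a ha b hb c hc hab hac hbc
        · rcases eq_or_ne b d with rfl | hbd
          · have : equalPairs a b c b = 1 := by grind [equalPairs]
            rw [this, s1 a b c b, s3 b a c b, s2 b a b c]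
            exact h1 b hb a ha c hc hab.symm hbc hac
          · rcases eq_or_ne c d with rfl | hcd
            · have : equalPairs a b c c = 1 := by grind [equalPairs]
              rw [this, s2 a b c c, s1 a c b c, s3 c a b c, s2 c a c b]
              exact h1 c hc a ha b hb hac.symm hbc.symm hab
            · have : equalPairs a b c d = 0 := by grind [equalPairs]
              rw [this]
              exact h0 hab hac had hbc hbd hcd

/-- The coefficient of the words with `t` pairs of equal letters in the expansion of the product
of the differences along a list of four edges. -/
def typeCoeff : List (ℕ × ℕ) → ℕ → ℤ
  | [e₁, e₂, e₃, e₄], t =>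
    ∑ ε₁ : Bool, ∑ ε₂ : Bool, ∑ ε₃ : Bool, ∑ ε₄ : Bool,
      (bif ε₁ then -1 else 1) * (bif ε₂ then -1 else 1) * (bif ε₃ then -1 else 1) *
        (bif ε₄ then -1 else 1) *
        if equalPairs (bif ε₁ then e₁.2 else e₁.1) (bif ε₂ then e₂.2 else e₂.1)
          (bif ε₃ then e₃.2 else e₃.1) (bif ε₄ then e₄.2 else e₄.1) = t then 1 else 0
  | _, _ => 0

theorem equalPairs_lt (a b c d : ℕ) : equalPairs a b c d < 7 := by
  unfold equalPairs
  split_ifs <;> simp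

theorem typeSum_eq_sum {N t : ℕ} (ht : t < 7) :
    typeSum N t = ∑ s ∈ Finset.range 7, (if t = s then 1 else 0) * typeSum N s := by
  simp [ht]

/-- Each Boolean chooses the endpoint taken from one factor, the second endpoint contributing a
sign. Since `typeCoeff` does not involve `N`, integer identities between coefficients transfer to
polynomials in any admissible number of variables. -/
theorem symEdges_eq_sum {N : ℕ} {l : List (ℕ × ℕ)} (hl : l.length = 4)
    (hN : ∀ e ∈ l, e.1 < N ∧ e.2 < N) :
    symEdges N l = ∑ t ∈ Finset.range 7, (typeCoeff l t : MvPolynomial (Fin N) ℝ) * typeSum N t := by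
  obtain ⟨e₁, e₂, e₃, e₄, rfl⟩ : ∃ e₁ e₂ e₃ e₄, l = [e₁, e₂, e₃, e₄] := by
    match l, hl with
    | [a, b, c, d], _ => exact ⟨a, b, c, d, rfl⟩
  have hpick : ∀ e ∈ [e₁, e₂, e₃, e₄], ∀ ε : Bool, (bif ε then e.2 else e.1) < N := by
    intro e he ε
    cases ε
    exacts [(hN e he).1, (hN e he).2]
  have h1 : symEdges N [e₁, e₂, e₃, e₄] =
      ∑ ε₁ : Bool, ∑ ε₂ : Bool, ∑ ε₃ : Bool, ∑ ε₄ : Bool,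
      (bif ε₁ then -1 else 1) * (bif ε₂ then -1 else 1) * (bif ε₃ then -1 else 1) *
        (bif ε₄ then -1 else 1) *
        wordSum N (bif ε₁ then e₁.2 else e₁.1) (bif ε₂ then e₂.2 else e₂.1)
          (bif ε₃ then e₃.2 else e₃.1) (bif ε₄ then e₄.2 else e₄.1) := by
    simp only [Fintype.sum_bool, cond_true, cond_false, wordSum, Finset.mul_sum,
      ← Finset.sum_add_distrib, symEdges]
    refine Finset.sum_congr rfl fun σ _ => ?_
    simp only [List.map_cons, List.map_nil, List.prod_cons, List.prod_nil]
    ring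
  rw [h1]
  simp only [typeCoeff, Int.cast_sum, Finset.sum_mul]
  simp only [Finset.sum_comm (s := Finset.range 7)]
  refine Finset.sum_congr rfl fun ε₁ _ => Finset.sum_congr rfl fun ε₂ _ =>
    Finset.sum_congr rfl fun ε₃ _ => Finset.sum_congr rfl fun ε₄ _ => ?_
  rw [wordSum_eq_typeSum (hpick _ (by simp) _) (hpick _ (by simp) _) (hpick _ (by simp) _)
    (hpick _ (by simp) _), typeSum_eq_sum (equalPairs_lt _ _ _ _), Finset.mul_sum]
  refine Finset.sum_congr rfl fun t _ => ?_
  cases ε₁ <;> cases ε₂ <;> cases ε₃ <;> cases ε₄ <;> simp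

/-! ### Relations between the symmetrized monomials and sums of squares -/

/-- The representatives of the classes of proportional symmetrized monomials. -/
def classReps : Fin 4 → Finset (Fin 23) :=
  ![{0, 1, 3}, {6, 7, 9, 10, 15, 17, 18, 20}, {5}, {14}]

/-- The graphs whose symmetrized monomial vanishes. -/
def zeroReps : Finset (Fin 23) := {2, 4, 8, 11, 12, 13, 16, 19, 21, 22}

/-- A distinguished element of each class. -/
def mainRep : Fin 4 → Fin 23 := ![0, 9, 5, 14]

theorem repEdges_length : ∀ i, (repEdges i).length = 4 := by decide +kernel

theorem lt_repSize {i : Fin 23} : ∀ e ∈ repEdges i, e.1 < repSize i ∧ e.2 < repSize i := by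
  intro e he
  have hmem : s(e.1, e.2) ∈ undirected (repEdges i) :=
    Multiset.mem_coe.2 (List.mem_map.2 ⟨e, he, rfl⟩)
  exact ⟨lt_vertexBound_of_mem hmem (by simp), lt_vertexBound_of_mem hmem (by simp)⟩

theorem typeCoeff_eq_zero : ∀ i ∈ zeroReps, ∀ t ∈ Finset.range 7, typeCoeff (repEdges i) t = 0 := by
  decide +kernel

theorem repSize_mainRep_le : ∀ j, ∀ i ∈ classReps j, repSize (mainRep j) ≤ repSize i := by
  decide +kernel

/-- The edges of the representatives are directed so that the factor `k` is positive, so that being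
a sum of squares passes from the distinguished element to the whole class with the listed
orientations. -/
theorem exists_mul_typeCoeff_eq : ∀ j, ∀ i ∈ classReps j, ∃ k ∈ Finset.Icc (1 : ℤ) 4,
    ∀ t ∈ Finset.range 7, k * typeCoeff (repEdges i) t =
      typeCoeff (repEdges (mainRep j)) t := by
  decide +kernel

theorem mem_classReps_or_mem_zeroReps : ∀ i, (∃ j, i ∈ classReps j) ∨ i ∈ zeroReps := by
  decide +kernel

theorem symEdges_repEdges {N : ℕ} {i : Fin 23} (hN : repSize i ≤ N) : symEdges N (repEdges i) =
    ∑ t ∈ Finset.range 7, (typeCoeff (repEdges i) t : MvPolynomial (Fin N) ℝ) * typeSum N t :=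
  symEdges_eq_sum (repEdges_length i) fun e he =>
    ⟨(lt_repSize e he).1.trans_le hN, (lt_repSize e he).2.trans_le hN⟩

theorem symEdges_eq_zero {N : ℕ} {i : Fin 23} (hi : i ∈ zeroReps) (hN : repSize i ≤ N) :
    symEdges N (repEdges i) = 0 := by
  rw [symEdges_repEdges hN]
  exact Finset.sum_eq_zero fun t ht => by rw [typeCoeff_eq_zero i hi t ht, Int.cast_zero, zero_mul]

theorem exists_smul_symEdges_eq (j : Fin 4) (i : Fin 23) (hi : i ∈ classReps j) :
    ∃ k : ℝ, 0 < k ∧ ∀ N, repSize i ≤ N →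
      symEdges N (repEdges i) = k • symEdges N (repEdges (mainRep j)) := by
  obtain ⟨k, hk, h⟩ := exists_mul_typeCoeff_eq j i hi
  have hk0 : (0 : ℝ) < k := by exact_mod_cast (Finset.mem_Icc.1 hk).1
  refine ⟨(k : ℝ)⁻¹, inv_pos.2 hk0, fun N hN => ?_⟩
  rw [eq_inv_smul_iff₀ hk0.ne', symEdges_repEdges hN,
    symEdges_repEdges ((repSize_mainRep_le j i hi).trans hN), Finset.smul_sum]
  refine Finset.sum_congr rfl fun t ht => ?_
  rw [← h t ht, Int.cast_smul_eq_zsmul, zsmul_eq_mul]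
  push_cast
  ring

/-- The symmetrized monomial of the distinguished element of a class. -/
noncomputable abbrev mainSym (N : ℕ) (j : Fin 4) : MvPolynomial (Fin N) ℝ :=
  symEdges N (repEdges (mainRep j))

theorem repEdges_mainRep_zero : repEdges (mainRep 0) = [(0, 1), (0, 1), (0, 1), (0, 1)] := by
  decide
theorem repEdges_mainRep_one : repEdges (mainRep 1) = [(0, 1), (0, 1), (2, 3), (2, 3)] := by
  decide
theorem repEdges_mainRep_two : repEdges (mainRep 2) = [(0, 1), (0, 1), (0, 2), (0, 3)] := by
  decide
theorem repEdges_mainRep_three : repEdges (mainRep 3) = [(0, 1), (0, 2), (0, 3), (0, 4)] := by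
  decide

theorem mainSym_zero_eq {N : ℕ} (hN : 4 ≤ N) :
    mainSym N 0 = 2 * mainSym N 2 + mainSym N 1 := by
  have h : ∀ t ∈ Finset.range 7, typeCoeff (repEdges (mainRep 0)) t =
      2 * typeCoeff (repEdges (mainRep 2)) t + typeCoeff (repEdges (mainRep 1)) t := by
    decide +kernel
  rw [mainSym, mainSym, mainSym, symEdges_repEdges (le_trans (by decide) hN),
    symEdges_repEdges (le_trans (by decide) hN), symEdges_repEdges (le_trans (by decide) hN),
    Finset.mul_sum, ← Finset.sum_add_distrib]
  refine Finset.sum_congr rfl fun t ht => ?_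
  rw [h t ht]
  push_cast
  ring

theorem mainSym_three_eq {N : ℕ} (hN : 5 ≤ N) :
    4 * mainSym N 3 = 4 * mainSym N 2 - mainSym N 1 := by
  have h : ∀ t ∈ Finset.range 7, 4 * typeCoeff (repEdges (mainRep 3)) t =
      4 * typeCoeff (repEdges (mainRep 2)) t - typeCoeff (repEdges (mainRep 1)) t := by
    decide +kernel
  rw [mainSym, mainSym, mainSym, symEdges_repEdges (le_trans (by decide) hN),
    symEdges_repEdges (le_trans (by decide) hN), symEdges_repEdges (le_trans (by decide) hN),
    Finset.mul_sum, Finset.mul_sum, ← Finset.sum_sub_distrib]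
  refine Finset.sum_congr rfl fun t ht => ?_
  have := congrArg (Int.cast : ℤ → MvPolynomial (Fin N) ℝ) (h t ht)
  push_cast at this
  linear_combination typeSum N t * this

theorem mainSym_zero_eq_sum (N : ℕ) : mainSym N 0 = ∑ σ : Equiv.Perm (Fin N),
    ((permVar σ 0 - permVar σ 1) ^ 2) ^ 2 := by
  rw [mainSym, repEdges_mainRep_zero, symEdges]
  refine Finset.sum_congr rfl fun σ _ => ?_
  simp only [List.map_cons, List.map_nil, List.prod_cons, List.prod_nil]
  ring

theorem mainSym_one_eq_sum (N : ℕ) : mainSym N 1 = ∑ σ : Equiv.Perm (Fin N),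
    ((permVar σ 0 - permVar σ 1) * (permVar σ 2 - permVar σ 3)) ^ 2 := by
  rw [mainSym, repEdges_mainRep_one, symEdges]
  refine Finset.sum_congr rfl fun σ _ => ?_
  simp only [List.map_cons, List.map_nil, List.prod_cons, List.prod_nil]
  ring

/-- Expanding the second factor of the square gives three four-edge monomials: two pairs of adjacent
double edges and a cross term with coefficient 2. Their coefficient vectors add up to twice that of
the star with a doubled edge. -/
theorem two_mul_mainSym_two_eq_sum {N : ℕ} (hN : 4 ≤ N) :
    2 * mainSym N 2 = ∑ σ : Equiv.Perm (Fin N), ((permVar σ 0 - permVar σ 1) *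
      ((permVar σ 0 - permVar σ 2) + (permVar σ 1 - permVar σ 3))) ^ 2 := by
  have h : ∀ t ∈ Finset.range 7, 2 * typeCoeff [(0, 1), (0, 1), (0, 2), (0, 3)] t =
      typeCoeff [(0, 1), (0, 1), (0, 2), (0, 2)] t +
      2 * typeCoeff [(0, 1), (0, 1), (0, 2), (1, 3)] t +
      typeCoeff [(0, 1), (0, 1), (1, 3), (1, 3)] t := by
    decide +kernel
  have h' : 2 * mainSym N 2 = symEdges N [(0, 1), (0, 1), (0, 2), (0, 2)] +
      2 * symEdges N [(0, 1), (0, 1), (0, 2), (1, 3)] +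
      symEdges N [(0, 1), (0, 1), (1, 3), (1, 3)] := by
    have hlt : ∀ e : ℕ × ℕ, e.1 < 4 ∧ e.2 < 4 → e.1 < N ∧ e.2 < N := fun e he =>
      ⟨he.1.trans_le hN, he.2.trans_le hN⟩
    rw [mainSym, repEdges_mainRep_two, symEdges_eq_sum rfl fun e he => hlt e (by revert e; decide),
      symEdges_eq_sum rfl fun e he => hlt e (by revert e; decide),
      symEdges_eq_sum rfl fun e he => hlt e (by revert e; decide),
      symEdges_eq_sum rfl fun e he => hlt e (by revert e; decide), Finset.mul_sum, Finset.mul_sum,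
      ← Finset.sum_add_distrib, ← Finset.sum_add_distrib]
    refine Finset.sum_congr rfl fun t ht => ?_
    have := congrArg (Int.cast : ℤ → MvPolynomial (Fin N) ℝ) (h t ht)
    push_cast at this
    linear_combination typeSum N t * this
  rw [h']
  simp only [symEdges, Finset.mul_sum, ← Finset.sum_add_distrib]
  refine Finset.sum_congr rfl fun σ _ => ?_
  simp only [List.map_cons, List.map_nil, List.prod_cons, List.prod_nil]
  ring

theorem isSumSq_mainSym_zero (N : ℕ) : IsSumSq (mainSym N 0) := by
  rw [mainSym_zero_eq_sum]
  exact IsSumSq.sum_sq _ _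

theorem isSumSq_mainSym_one (N : ℕ) : IsSumSq (mainSym N 1) := by
  rw [mainSym_one_eq_sum]
  exact IsSumSq.sum_sq _ _

theorem IsSumSq.smul_mvPolynomial {τ : Type*} {p : MvPolynomial τ ℝ} (hp : IsSumSq p) {c : ℝ}
    (hc : 0 ≤ c) : IsSumSq (c • p) := by
  rw [smul_eq_C_mul]
  refine IsSumSq.mul ?_ hp
  rw [← Real.mul_self_sqrt hc, C_mul]
  exact IsSumSq.mul_self _

theorem isSumSq_mainSym_two {N : ℕ} (hN : 4 ≤ N) : IsSumSq (mainSym N 2) := by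
  have h : mainSym N 2 = (2⁻¹ : ℝ) • (2 * mainSym N 2) := by
    rw [eq_inv_smul_iff₀ two_ne_zero, two_smul, two_mul]
  rw [h, two_mul_mainSym_two_eq_sum hN]
  exact IsSumSq.smul_mvPolynomial (IsSumSq.sum_sq _ _) (by norm_num)

theorem IsSumSq.eval_nonneg {τ : Type*} {p : MvPolynomial τ ℝ} (hp : IsSumSq p) (x : τ → ℝ) :
    0 ≤ eval x p := by
  induction hp with
  | zero => simp
  | sq_add a _ ih =>
    rw [map_add, map_mul]
    exact add_nonneg (mul_self_nonneg _) ih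

/-! ### Linear independence -/

theorem eval_permVar {N : ℕ} (f : ℕ → ℝ) (σ : Equiv.Perm (Fin N)) {a : ℕ} (ha : a < N) :
    eval (fun i : Fin N => f i.1) (permVar σ a) = f (σ ⟨a, ha⟩).1 := by
  simp [permVar, ha]

theorem eval_mainSym_zero_pos {N : ℕ} (hN : 2 ≤ N) :
    0 < eval (fun i : Fin N => if i.1 = 0 then (1 : ℝ) else 0) (mainSym N 0) := by
  rw [mainSym_zero_eq_sum, map_sum]
  refine Finset.sum_pos' (fun σ _ => by rw [map_pow]; positivity) ⟨1, Finset.mem_univ _, ?_⟩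
  simp only [map_pow, map_sub]
  rw [eval_permVar (fun a => if a = 0 then 1 else 0) 1 (by omega : 0 < N),
    eval_permVar (fun a => if a = 0 then 1 else 0) 1 (by omega : 1 < N)]
  simp

theorem eval_mainSym_two_pos {N : ℕ} (hN : 4 ≤ N) :
    0 < eval (fun i : Fin N => if i.1 = 0 then (1 : ℝ) else 0) (mainSym N 2) := by
  suffices h : 0 < eval (fun i : Fin N => if i.1 = 0 then (1 : ℝ) else 0) (2 * mainSym N 2) by
    rw [map_mul, map_ofNat] at h
    linarith
  rw [two_mul_mainSym_two_eq_sum hN, map_sum]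
  refine Finset.sum_pos' (fun σ _ => by rw [map_pow]; positivity) ⟨1, Finset.mem_univ _, ?_⟩
  simp only [map_pow, map_sub, map_mul, map_add]
  rw [eval_permVar (fun a => if a = 0 then 1 else 0) 1 (by omega : 0 < N),
    eval_permVar (fun a => if a = 0 then 1 else 0) 1 (by omega : 1 < N),
    eval_permVar (fun a => if a = 0 then 1 else 0) 1 (by omega : 2 < N),
    eval_permVar (fun a => if a = 0 then 1 else 0) 1 (by omega : 3 < N)]
  simp

theorem eval_mainSym_one_pos {N : ℕ} (hN : 4 ≤ N) :
    0 < eval (fun i : Fin N => if i.1 = 0 ∨ i.1 = 2 then (1 : ℝ) else 0) (mainSym N 1) := by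
  rw [mainSym_one_eq_sum, map_sum]
  refine Finset.sum_pos' (fun σ _ => by rw [map_pow]; positivity) ⟨1, Finset.mem_univ _, ?_⟩
  simp only [map_pow, map_sub, map_mul]
  rw [eval_permVar (fun a => if a = 0 ∨ a = 2 then 1 else 0) 1 (by omega : 0 < N),
    eval_permVar (fun a => if a = 0 ∨ a = 2 then 1 else 0) 1 (by omega : 1 < N),
    eval_permVar (fun a => if a = 0 ∨ a = 2 then 1 else 0) 1 (by omega : 2 < N),
    eval_permVar (fun a => if a = 0 ∨ a = 2 then 1 else 0) 1 (by omega : 3 < N)]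
  simp

/-- With a single non-zero coordinate, one of the two disjoint edges joins equal values, so every
summand vanishes. -/
theorem eval_mainSym_one_eq_zero {N : ℕ} (hN : 4 ≤ N) :
    eval (fun i : Fin N => if i.1 = 0 then (1 : ℝ) else 0) (mainSym N 1) = 0 := by
  rw [mainSym_one_eq_sum, map_sum]
  refine Finset.sum_eq_zero fun σ _ => ?_
  simp only [map_pow, map_sub, map_mul]
  have hne : ∀ a b (ha : a < N) (hb : b < N), a ≠ b → (σ ⟨a, ha⟩).1 ≠ (σ ⟨b, hb⟩).1 :=
    fun a b ha hb hab h => hab (by simpa using σ.injective (Fin.ext h))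
  have h02 := hne 0 2 (by omega) (by omega) (by omega)
  have h03 := hne 0 3 (by omega) (by omega) (by omega)
  have h12 := hne 1 2 (by omega) (by omega) (by omega)
  have h13 := hne 1 3 (by omega) (by omega) (by omega)
  rw [eval_permVar (fun a => if a = 0 then 1 else 0) σ (by omega : 0 < N),
    eval_permVar (fun a => if a = 0 then 1 else 0) σ (by omega : 1 < N),
    eval_permVar (fun a => if a = 0 then 1 else 0) σ (by omega : 2 < N),
    eval_permVar (fun a => if a = 0 then 1 else 0) σ (by omega : 3 < N)]
  split_ifs <;> first | omega | simp

/-- The evaluations are triangular: a unit vector kills `mainSym N 1` but not `mainSym N 2`, and a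
point with two ones then detects `mainSym N 1`. -/
theorem mainSym_combination_eq_zero {N : ℕ} (hN : 4 ≤ N) {a b : ℝ}
    (h : C a * mainSym N 2 + C b * mainSym N 1 = 0) : a = 0 ∧ b = 0 := by
  have ha : a = 0 := by
    have := congrArg (eval (fun i : Fin N => if i.1 = 0 then (1 : ℝ) else 0)) h
    simp only [map_add, map_mul, eval_C, eval_mainSym_one_eq_zero hN, mul_zero, add_zero,
      map_zero] at this
    exact (mul_eq_zero.1 this).resolve_right (eval_mainSym_two_pos hN).ne'
  subst ha
  refine ⟨rfl, ?_⟩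
  have := congrArg (eval (fun i : Fin N => if i.1 = 0 ∨ i.1 = 2 then (1 : ℝ) else 0)) h
  simp only [map_mul, eval_C, zero_mul, zero_add, map_zero] at this
  exact (mul_eq_zero.1 this).resolve_right (eval_mainSym_one_pos hN).ne'

/-- The coordinates of four times the main symmetrized monomials. -/
def mainCoord : Fin 4 → ℝ × ℝ := ![(8, 4), (0, 4), (4, 0), (4, -1)]

theorem four_mul_mainSym {N : ℕ} (hN : 4 ≤ N) {j : Fin 4} (hj : repSize (mainRep j) ≤ N) :
    4 * mainSym N j = C (mainCoord j).1 * mainSym N 2 + C (mainCoord j).2 * mainSym N 1 := by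
  have hC4 : (C 4 : MvPolynomial (Fin N) ℝ) = 4 := map_ofNat C 4
  have hC8 : (C 8 : MvPolynomial (Fin N) ℝ) = 8 := map_ofNat C 8
  fin_cases j
  · change 4 * mainSym N 0 = C 8 * _ + C 4 * _
    rw [hC8, hC4, mainSym_zero_eq hN]
    ring
  · change 4 * mainSym N 1 = C 0 * _ + C 4 * _
    rw [hC4, C_0]
    ring
  · change 4 * mainSym N 2 = C 4 * _ + C 0 * _
    rw [hC4, C_0]
    ring
  · change 4 * mainSym N 3 = C 4 * _ + C (-1) * _
    rw [hC4, C_neg, C_1, mainSym_three_eq (le_trans (by decide) hj)]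
    ring

theorem mainSym_ne_zero {N : ℕ} {j : Fin 4} (hj : repSize (mainRep j) ≤ N) : mainSym N j ≠ 0 := by
  intro h
  by_cases hN : 4 ≤ N
  · have h4 := four_mul_mainSym hN hj
    rw [h, mul_zero] at h4
    obtain ⟨h1, h2⟩ := mainSym_combination_eq_zero hN h4.symm
    fin_cases j <;> simp [mainCoord] at h1 h2
  -- With fewer than four variables the basis is not available, but then only the class of the
  -- quadruple edge can occur.
  · have h0 : ∀ j, repSize (mainRep j) < 4 → j = 0 := by decide +kernel
    obtain rfl := h0 j (by omega)
    have := eval_mainSym_zero_pos (N := N) (le_trans (by decide) hj)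
    rw [h, map_zero] at this
    exact this.false

theorem eq_of_mainSym_eq_smul {N : ℕ} {i j : Fin 4} (hi : repSize (mainRep i) ≤ N)
    (hj : repSize (mainRep j) ≤ N) {c : ℝ} (h : mainSym N i = c • mainSym N j) : i = j := by
  by_contra hij
  have hsize : ∀ i j, i ≠ j → 4 ≤ repSize (mainRep i) ∨ 4 ≤ repSize (mainRep j) := by
    decide +kernel
  have hN : 4 ≤ N := by
    rcases hsize i j hij with h | h
    exacts [h.trans hi, h.trans hj]
  have h' : C ((mainCoord i).1 - c * (mainCoord j).1) * mainSym N 2 +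
      C ((mainCoord i).2 - c * (mainCoord j).2) * mainSym N 1 = 0 := by
    simp only [C_sub, C_mul]
    rw [smul_eq_C_mul] at h
    linear_combination 4 * h - four_mul_mainSym hN hi + C c * four_mul_mainSym hN hj
  obtain ⟨h1, h2⟩ := mainSym_combination_eq_zero hN h'
  fin_cases i <;> fin_cases j <;> simp [mainCoord] at h1 h2 hij <;> linarith

/-! ### The Lax graph -/

/-- The sum is symmetric, so the values may be sorted. The product at the median has two
non-positive and two non-negative factors. At each end, the extreme product is non-negative and
dominates the adjacent one: both contain the same gap up to sign, and the extreme point is farther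
from the remaining three. -/
theorem sum_prod_sub_nonneg (x : Fin 5 → ℝ) :
    0 ≤ ∑ i, ∏ j, if j = i then 1 else x i - x j := by
  have hmono : ∀ y : Fin 5 → ℝ, Monotone y → 0 ≤ ∑ i, ∏ j, if j = i then 1 else y i - y j := by
    intro y hy
    have h01 : y 0 ≤ y 1 := hy (by decide)
    have h12 : y 1 ≤ y 2 := hy (by decide)
    have h23 : y 2 ≤ y 3 := hy (by decide)
    have h34 : y 3 ≤ y 4 := hy (by decide)
    simp [Fin.sum_univ_five, Fin.prod_univ_five]
    have h1 : (y 1 - y 2) * (y 1 - y 3) * (y 1 - y 4) * (y 1 - y 0) +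
        (y 0 - y 1) * (y 0 - y 2) * (y 0 - y 3) * (y 0 - y 4) ≥ 0 := by
      have : (y 2 - y 1) * (y 3 - y 1) * (y 4 - y 1) ≤ (y 2 - y 0) * (y 3 - y 0) * (y 4 - y 0) := by
        have : 0 ≤ y 2 - y 0 := by linarith
        have : 0 ≤ y 3 - y 0 := by linarith
        have : 0 ≤ y 3 - y 1 := by linarith
        have : 0 ≤ y 4 - y 1 := by linarith
        gcongr
      nlinarith [mul_nonneg (sub_nonneg.2 h01) (sub_nonneg.2 this)]
    have h2 : (y 3 - y 0) * (y 3 - y 1) * (y 3 - y 2) * (y 3 - y 4) +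
        (y 4 - y 0) * (y 4 - y 1) * (y 4 - y 2) * (y 4 - y 3) ≥ 0 := by
      have : (y 3 - y 0) * (y 3 - y 1) * (y 3 - y 2) ≤ (y 4 - y 0) * (y 4 - y 1) * (y 4 - y 2) := by
        have : 0 ≤ y 4 - y 0 := by linarith
        have : 0 ≤ y 4 - y 1 := by linarith
        have : 0 ≤ y 3 - y 1 := by linarith
        have : 0 ≤ y 3 - y 2 := by linarith
        gcongr
      nlinarith [mul_nonneg (sub_nonneg.2 h34) (sub_nonneg.2 this)]
    have h3 : 0 ≤ ((y 2 - y 0) * (y 2 - y 1)) * ((y 3 - y 2) * (y 4 - y 2)) := by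
      apply mul_nonneg <;> apply mul_nonneg <;> linarith
    linarith
  convert hmono _ (Tuple.monotone_sort x) using 1
  rw [← Equiv.sum_comp (Tuple.sort x)]
  refine Finset.sum_congr rfl fun i _ => ?_
  rw [← Equiv.prod_comp (Tuple.sort x)]
  simp

theorem eval_mainSym_three {N : ℕ} (hN : 5 ≤ N) (x : Fin N → ℝ) :
    eval x (mainSym N 3) = ∑ σ : Equiv.Perm (Fin N), ∏ j : Fin 5,
      if j = 0 then 1 else x (σ (Fin.castLE hN 0)) - x (σ (Fin.castLE hN j)) := by
  rw [mainSym, repEdges_mainRep_three, symEdges, map_sum]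
  refine Finset.sum_congr rfl fun σ _ => ?_
  have h0 : 0 < N := by omega
  have h1 : 1 < N := by omega
  have h2 : 2 < N := by omega
  have h3 : 3 < N := by omega
  have h4 : 4 < N := by omega
  simp [permVar, h0, h1, h2, h3, h4, Fin.prod_univ_five, Fin.castLE, mul_assoc]

/-- Any of the five vertices may serve as center without changing the symmetrization. Averaging over
the five choices reduces to the five-point inequality for each permutation. -/
theorem eval_mainSym_three_nonneg {N : ℕ} (hN : 5 ≤ N) (x : Fin N → ℝ) :
    0 ≤ eval x (mainSym N 3) := by
  have h2 : ∀ i : Fin 5, eval x (mainSym N 3) = ∑ σ : Equiv.Perm (Fin N), ∏ j : Fin 5,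
      if j = i then 1 else x (σ (Fin.castLE hN i)) - x (σ (Fin.castLE hN j)) := by
    intro i
    rw [eval_mainSym_three hN]
    refine (sum_perm_comp_embedding (Fin.castLEEmb hN)
      ((Equiv.swap 0 i).toEmbedding.trans (Fin.castLEEmb hN))
      fun g => ∏ j : Fin 5, if j = 0 then 1 else x (g 0) - x (g j)).trans ?_
    refine Finset.sum_congr rfl fun σ _ => ?_
    rw [← Equiv.prod_comp (Equiv.swap 0 i)]
    refine Finset.prod_congr rfl fun j _ => ?_
    have : Equiv.swap 0 i j = 0 ↔ j = i := by
      rw [← Equiv.eq_symm_apply]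
      simp
    simp [this]
  have h3 : 5 * eval x (mainSym N 3) = ∑ σ : Equiv.Perm (Fin N), ∑ i : Fin 5, ∏ j : Fin 5,
      if j = i then 1 else x (σ (Fin.castLE hN i)) - x (σ (Fin.castLE hN j)) := by
    rw [Finset.sum_comm, ← Finset.sum_congr rfl fun i _ => h2 i]
    simp
  have h4 : 0 ≤ 5 * eval x (mainSym N 3) := by
    rw [h3]
    exact Finset.sum_nonneg fun σ _ => sum_prod_sub_nonneg fun i => x (σ (Fin.castLE hN i))
  linarith

/-! ### The Lax polynomial is not a sum of squares -/

/-- The homogeneous part of degree two of a polynomial, evaluated at a point. -/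
noncomputable def quadPart {τ : Type*} (x : τ → ℝ) : MvPolynomial τ ℝ →ₗ[ℝ] ℝ :=
  Polynomial.lcoeff ℝ 2 ∘ₗ
    (aeval fun i => Polynomial.C (x i) * Polynomial.X : MvPolynomial τ ℝ →ₐ[ℝ] _).toLinearMap

theorem quadPart_apply {τ : Type*} (x : τ → ℝ) (p : MvPolynomial τ ℝ) : quadPart x p =
    (aeval (fun i => Polynomial.C (x i) * Polynomial.X : τ → Polynomial ℝ) p).coeff 2 := rfl

/-- If a sum of squares of real polynomials is a multiple of `X ^ 4`, then the leading coefficient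
is the sum of the squares of the coefficients of degree two. -/
theorem coeff_four_sum_sq {ι : Type*} (s : Finset ι) (g : ι → Polynomial ℝ) {c : ℝ}
    (h : ∑ k ∈ s, g k ^ 2 = Polynomial.C c * Polynomial.X ^ 4) :
    c = ∑ k ∈ s, (g k).coeff 2 ^ 2 := by
  have hc : ∀ n, ∑ k ∈ s, (g k ^ 2).coeff n = if n = 4 then c else 0 := by
    intro n
    rw [← Polynomial.finsetSum_coeff, h, Polynomial.coeff_C_mul_X_pow]
  have h0 : ∀ k ∈ s, (g k).coeff 0 = 0 := by
    have h2 : ∑ k ∈ s, (g k ^ 2).coeff 0 = 0 := hc 0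
    simp only [pow_two, Polynomial.mul_coeff_zero] at h2
    intro k hk
    exact mul_self_eq_zero.1
      ((Finset.sum_eq_zero_iff_of_nonneg fun _ _ => mul_self_nonneg _).1 h2 k hk)
  have h1 : ∀ k ∈ s, (g k).coeff 1 = 0 := by
    have h2 : ∑ k ∈ s, (g k).coeff 1 * (g k).coeff 1 = 0 := by
      rw [← show ∑ k ∈ s, (g k ^ 2).coeff 2 = 0 from hc 2]
      refine Finset.sum_congr rfl fun k hk => ?_
      simp [pow_two, Polynomial.coeff_mul, Finset.Nat.antidiagonal_succ, h0 k hk]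
    intro k hk
    exact mul_self_eq_zero.1
      ((Finset.sum_eq_zero_iff_of_nonneg fun _ _ => mul_self_nonneg _).1 h2 k hk)
  rw [← show ∑ k ∈ s, (g k ^ 2).coeff 4 = c from hc 4]
  refine Finset.sum_congr rfl fun k hk => ?_
  simp [pow_two, Polynomial.coeff_mul, Finset.Nat.antidiagonal_succ, h0 k hk, h1 k hk]

theorem IsSumSq.exists_finset {R : Type*} [CommSemiring R] {p : R} (hp : IsSumSq p) :
    ∃ (n : ℕ) (f : Fin n → R), p = ∑ k, f k ^ 2 := by
  induction hp with
  | zero => exact ⟨0, Fin.elim0, by simp⟩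
  | sq_add a _ ih =>
    obtain ⟨n, f, rfl⟩ := ih
    exact ⟨n + 1, Fin.cons a f, by simp [Fin.sum_univ_succ, pow_two]⟩

theorem aeval_line_monomial {τ : Type*} (x : τ → ℝ) (m : τ →₀ ℕ) (a : ℝ) :
    aeval (fun i => Polynomial.C (x i) * Polynomial.X : τ → Polynomial ℝ) (monomial m a) =
      Polynomial.C (eval x (monomial m a)) * Polynomial.X ^ m.degree := by
  rw [aeval_monomial, eval_monomial, Finsupp.prod, Finsupp.prod]
  simp only [mul_pow, Finset.prod_mul_distrib, Finset.prod_pow_eq_pow_sum]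
  rw [Finsupp.degree_apply]
  simp [map_mul, map_prod, mul_assoc]

theorem aeval_line_of_isHomogeneous {τ : Type*} {p : MvPolynomial τ ℝ} {d : ℕ}
    (hp : p.IsHomogeneous d) (x : τ → ℝ) :
    aeval (fun i => Polynomial.C (x i) * Polynomial.X : τ → Polynomial ℝ) p =
      Polynomial.C (eval x p) * Polynomial.X ^ d := by
  conv_lhs => rw [p.as_sum]
  conv_rhs => rw [p.as_sum]
  simp only [map_sum, Finset.sum_mul]
  refine Finset.sum_congr rfl fun m hm => ?_
  have hd : m.degree = d := by
    by_contra h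
    exact mem_support_iff.1 hm (hp.coeff_eq_zero h)
  rw [aeval_line_monomial, hd]

/-- Restriction to the line through the origin and `x` turns the identity into one in a single
variable. Thus the summands `f k` need not be assumed homogeneous. -/
theorem eval_eq_sum_quadPart {τ ι : Type*} {p : MvPolynomial τ ℝ} (hp : p.IsHomogeneous 4)
    (s : Finset ι) (f : ι → MvPolynomial τ ℝ) (h : p = ∑ k ∈ s, f k ^ 2) (x : τ → ℝ) :
    eval x p = ∑ k ∈ s, quadPart x (f k) ^ 2 := by
  refine coeff_four_sum_sq s
    (fun k => aeval (fun i => Polynomial.C (x i) * Polynomial.X : τ → Polynomial ℝ) (f k)) ?_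
  rw [← aeval_line_of_isHomogeneous hp, h]
  simp

/-- The indicator function of a finset. -/
def indicatorPoint (s : Finset (Fin 5)) (i : Fin 5) : ℝ := if i ∈ s then 1 else 0

theorem exists_single_add_single {τ : Type*} {m : τ →₀ ℕ} (hm : m.degree = 2) :
    ∃ i j, m = Finsupp.single i 1 + Finsupp.single j 1 := by
  classical
  have h : (Finsupp.toMultiset m).card = 2 := by rw [Finsupp.card_toMultiset]; exact hm
  obtain ⟨i, j, hij⟩ := Multiset.card_eq_two.1 h
  refine ⟨i, j, Multiset.toFinsupp.symm.injective ?_⟩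
  change Finsupp.toMultiset m = Finsupp.toMultiset _
  rw [hij, map_add, Finsupp.toMultiset_single, Finsupp.toMultiset_single]
  rfl

/-- A linear relation between the values of a quadratic form in five variables at points with
coordinates in `{0, 1}`. -/
theorem quadPart_indicatorPoint (p : MvPolynomial (Fin 5) ℝ) :
    3 * quadPart (indicatorPoint {0}) p =
      (∑ s : Finset (Fin 5) with 0 ∈ s ∧ s.card = 2, quadPart (indicatorPoint s) p) -
      (∑ s : Finset (Fin 5) with 0 ∉ s ∧ s.card = 2, quadPart (indicatorPoint s) p) +
      (∑ s : Finset (Fin 5) with 0 ∉ s ∧ s.card = 3, quadPart (indicatorPoint s) p) -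
      quadPart (indicatorPoint Finset.univ) p := by
  induction p using MvPolynomial.induction_on' with
  | add p q hp hq =>
    simp only [map_add, Finset.sum_add_distrib]
    linear_combination hp + hq
  | monomial m a =>
    by_cases hm : m.degree = 2
    · obtain ⟨i, j, rfl⟩ := exists_single_add_single hm
      have hq : ∀ s, quadPart (indicatorPoint s)
          (monomial (Finsupp.single i 1 + Finsupp.single j 1) a) =
            a * ((if i ∈ s ∧ j ∈ s then 1 else 0 : ℤ) : ℝ) := by
        intro s
        rw [quadPart_apply, aeval_line_monomial, Polynomial.coeff_C_mul_X_pow, if_pos hm.symm,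
          ← mul_one a, ← monomial_mul, map_mul, eval_monomial, eval_monomial]
        by_cases hi : i ∈ s <;> by_cases hj : j ∈ s <;> simp [indicatorPoint, hi, hj]
      -- A monomial `X i * X j` takes the value 1 at the indicator of `s` exactly when both indices
      -- lie in `s`, so the relation is a count of subsets. For the index sets `{0}`, `{0, a}`,
      -- `{a}`, `{a, b}` with `a`, `b` distinct and non-zero, the right side is 4 - 1, 1 - 1, 1 - 3
      -- + 3 - 1 and -1 + 2 - 1.
      have key : ∀ i j : Fin 5, 3 * (if i ∈ ({0} : Finset (Fin 5)) ∧ j ∈ ({0} : Finset (Fin 5))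
          then 1 else 0 : ℤ) =
          (∑ s : Finset (Fin 5) with 0 ∈ s ∧ s.card = 2, if i ∈ s ∧ j ∈ s then 1 else 0) -
          (∑ s : Finset (Fin 5) with 0 ∉ s ∧ s.card = 2, if i ∈ s ∧ j ∈ s then 1 else 0) +
          (∑ s : Finset (Fin 5) with 0 ∉ s ∧ s.card = 3, if i ∈ s ∧ j ∈ s then 1 else 0) -
          if i ∈ (Finset.univ : Finset (Fin 5)) ∧ j ∈ (Finset.univ : Finset (Fin 5))
          then 1 else 0 := by
        decide +kernel
      have key' := congrArg (Int.cast : ℤ → ℝ) (key i j)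
      rw [Int.cast_sub, Int.cast_add, Int.cast_sub, Int.cast_mul, Int.cast_sum, Int.cast_sum,
        Int.cast_sum] at key'
      simp only [hq, ← Finset.mul_sum]
      linear_combination a * key'
    · have hq : ∀ s, quadPart (indicatorPoint s) (monomial m a) = 0 := by
        intro s
        rw [quadPart_apply, aeval_line_monomial, Polynomial.coeff_C_mul_X_pow,
          if_neg (Ne.symm hm)]
      simp [hq]

/-- For these sizes neither `s` nor its complement is a singleton, so whichever variable sits at the
center, some leaf has the same value and contributes a zero factor. -/
theorem eval_mainSym_three_eq_zero {s : Finset (Fin 5)} (hs : s.card = 2 ∨ s.card = 3 ∨ s.card = 5) :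
    eval (indicatorPoint s) (mainSym 5 3) = 0 := by
  rw [eval_mainSym_three le_rfl]
  refine Finset.sum_eq_zero fun σ _ => ?_
  have htwin : ∀ s : Finset (Fin 5), s.card = 2 ∨ s.card = 3 ∨ s.card = 5 →
      ∀ i, ∃ j, j ≠ i ∧ (j ∈ s ↔ i ∈ s) := by decide +kernel
  obtain ⟨j, hj, hjs⟩ := htwin s hs (σ 0)
  refine Finset.prod_eq_zero (Finset.mem_univ (σ.symm j)) ?_
  rw [if_neg fun h => hj (by rw [← h, Equiv.apply_symm_apply])]
  simp [indicatorPoint, hjs]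

theorem eval_mainSym_three_pos : 0 < eval (indicatorPoint {0}) (mainSym 5 3) := by
  have h := congrArg (eval (fun i : Fin 5 => if i.1 = 0 then (1 : ℝ) else 0))
    (mainSym_three_eq (N := 5) le_rfl)
  rw [map_sub, eval_mainSym_one_eq_zero (by omega), map_mul, map_mul, map_ofNat] at h
  have hpt : indicatorPoint {0} = fun i : Fin 5 => if i.1 = 0 then (1 : ℝ) else 0 := by
    funext i
    fin_cases i <;> simp [indicatorPoint]
  rw [hpt]
  linarith [eval_mainSym_two_pos (N := 5) (by omega)]

theorem isHomogeneous_mainSym_three : (mainSym 5 3).IsHomogeneous 4 := by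
  rw [mainSym, repEdges_mainRep_three, symEdges]
  refine IsHomogeneous.sum _ _ _ fun σ _ => ?_
  have h : ∀ a < 5, (permVar σ a).IsHomogeneous 1 := fun a ha => by
    rw [permVar, dif_pos ha]
    exact isHomogeneous_X _ _
  have h' : ∀ a < 5, (permVar σ 0 - permVar σ a).IsHomogeneous 1 := fun a ha =>
    (h 0 (by omega)).sub (h a ha)
  simp only [List.map_cons, List.map_nil, List.prod_cons, List.prod_nil, mul_one]
  exact (h' 1 (by omega)).mul ((h' 2 (by omega)).mul ((h' 3 (by omega)).mul (h' 4 (by omega))))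

/-- Both signs are treated because an arbitrary orientation of the Lax graph determines its
polynomial only up to sign. -/
theorem not_isSumSq_of_eq_or_eq_neg {p : MvPolynomial (Fin 5) ℝ}
    (hp : p = mainSym 5 3 ∨ p = -mainSym 5 3) : ¬ IsSumSq p := by
  intro h
  obtain ⟨n, f, hf⟩ := IsSumSq.exists_finset h
  have hhom : p.IsHomogeneous 4 := by
    rcases hp with rfl | rfl
    exacts [isHomogeneous_mainSym_three, isHomogeneous_mainSym_three.neg]
  have hev := eval_eq_sum_quadPart hhom Finset.univ f hf
  have hzero : ∀ s : Finset (Fin 5), s.card = 2 ∨ s.card = 3 ∨ s.card = 5 → ∀ k,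
      quadPart (indicatorPoint s) (f k) = 0 := by
    intro s hs k
    have h0 : eval (indicatorPoint s) p = 0 := by
      rcases hp with rfl | rfl <;> simp [eval_mainSym_three_eq_zero hs]
    rw [hev] at h0
    exact pow_eq_zero_iff two_ne_zero |>.1
      ((Finset.sum_eq_zero_iff_of_nonneg fun _ _ => sq_nonneg _).1 h0 k (Finset.mem_univ k))
  have h1 : ∀ k, quadPart (indicatorPoint {0}) (f k) = 0 := by
    intro k
    have := quadPart_indicatorPoint (f k)
    rw [Finset.sum_eq_zero fun s hs => hzero s (Or.inl (Finset.mem_filter.1 hs).2.2) k,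
      Finset.sum_eq_zero fun s hs => hzero s (Or.inl (Finset.mem_filter.1 hs).2.2) k,
      Finset.sum_eq_zero fun s hs => hzero s (Or.inr (Or.inl (Finset.mem_filter.1 hs).2.2)) k,
      hzero Finset.univ (Or.inr (Or.inr rfl)) k] at this
    linarith
  have h2 : eval (indicatorPoint {0}) p = 0 := by
    rw [hev]
    simp [h1]
  have h3 := eval_mainSym_three_pos
  rcases hp with rfl | rfl
  · exact h3.ne' h2
  · rw [map_neg, neg_eq_zero] at h2
    exact h3.ne' h2

/-! ### The classes of graphs with four edges -/

/-- Pulling back the listed orientation along the isomorphism fixes the sign, with one choice that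
works for all `N`. -/
theorem exists_orientation {G : EdgeGraph 4} {i : Fin 23} (h : G ≈ repGraph i) :
    repSize i = G.n ∧ ∃ D : DiMultigraph (Fin G.n), D.IsOrientationOf G.graph ∧
      ∀ N, G.n ≤ N → (D.pad N).symMonomial = symEdges N (repEdges i) := by
  obtain ⟨f, hf⟩ := h
  have hn : G.n = repSize i := Fin.equiv_iff_eq.1 ⟨f⟩
  refine ⟨hn.symm, (repDigraph i).comap f, DiMultigraph.comap_isOrientationOf hf rfl,
    fun N hN => ?_⟩
  have hN' : repSize i ≤ N := hn.symm.trans_le hN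
  exact (DiMultigraph.pad_symMonomial_comap hN hN' f _).trans
    (pad_symMonomial_digraphOfEdges hN' (repEdges_fst_ne_snd i) lt_repSize)

theorem symMonomial_eq_or_eq_neg {G : EdgeGraph 4} {i : Fin 23} (h : G ≈ repGraph i)
    {D : DiMultigraph (Fin G.n)} (hD : D.IsOrientationOf G.graph) {N : ℕ} (hN : G.n ≤ N) :
    (D.pad N).symMonomial = symEdges N (repEdges i) ∨
      (D.pad N).symMonomial = -symEdges N (repEdges i) := by
  obtain ⟨-, E, hE, hEN⟩ := exists_orientation h
  rw [← hEN N hN]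
  exact DiMultigraph.pad_symMonomial_eq_or_eq_neg hN (hD.trans hE.symm)

theorem exists_eq_smul_mainSym {G : EdgeGraph 4} {j : Fin 4} (hG : G ∈ repClass (classReps j))
    {D : DiMultigraph (Fin G.n)} (hD : D.IsOrientationOf G.graph) {N : ℕ} (hN : G.n ≤ N) :
    repSize (mainRep j) ≤ N ∧ ∃ c : ℝ, c ≠ 0 ∧ (D.pad N).symMonomial = c • mainSym N j := by
  obtain ⟨i, hi, h⟩ := hG
  obtain ⟨k, hk, hkN⟩ := exists_smul_symEdges_eq j i hi
  have hN' : repSize i ≤ N := (exists_orientation h).1.trans_le hN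
  refine ⟨(repSize_mainRep_le j i hi).trans hN', ?_⟩
  rcases symMonomial_eq_or_eq_neg h hD hN with h' | h'
  · exact ⟨k, hk.ne', by rw [h', hkN N hN']⟩
  · exact ⟨-k, neg_ne_zero.2 hk.ne', by rw [h', hkN N hN', neg_smul]⟩

theorem symMonomial_ne_zero {G : EdgeGraph 4} {j : Fin 4} (hG : G ∈ repClass (classReps j))
    {D : DiMultigraph (Fin G.n)} (hD : D.IsOrientationOf G.graph) {N : ℕ} (hN : G.n ≤ N) :
    (D.pad N).symMonomial ≠ 0 := by
  obtain ⟨hj, c, hc, h⟩ := exists_eq_smul_mainSym hG hD hN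
  rw [h]
  exact smul_ne_zero hc (mainSym_ne_zero hj)

theorem vanishes_of_mem_zeroReps {G : EdgeGraph 4} (hG : G ∈ repClass zeroReps) : G.Vanishes := by
  obtain ⟨i, hi, h⟩ := hG
  intro D hD
  rw [← D.pad_self]
  have h0 := symEdges_eq_zero hi (exists_orientation h).1.le
  rcases symMonomial_eq_or_eq_neg h hD le_rfl with h' | h' <;> rw [h', h0]
  exact neg_zero

theorem not_vanishes_of_mem_classReps {G : EdgeGraph 4} {j : Fin 4}
    (hG : G ∈ repClass (classReps j)) : ¬ G.Vanishes := by
  intro hv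
  obtain ⟨i, hi, h⟩ := id hG
  obtain ⟨-, D, hD, -⟩ := exists_orientation h
  refine symMonomial_ne_zero hG hD le_rfl ?_
  rw [D.pad_self]
  exact hv D hD

theorem mem_repClass_or (G : EdgeGraph 4) :
    (∃ j, G ∈ repClass (classReps j)) ∨ G ∈ repClass zeroReps := by
  obtain ⟨i, hi⟩ := exists_equiv_repGraph G
  rcases mem_classReps_or_mem_zeroReps i with ⟨j, hj⟩ | h0
  · exact Or.inl ⟨j, i, hj, hi⟩
  · exact Or.inr ⟨i, h0, hi⟩

theorem setOf_vanishes : {G : EdgeGraph 4 | G.Vanishes} = repClass zeroReps := by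
  ext G
  refine ⟨fun hv => ?_, vanishes_of_mem_zeroReps⟩
  rcases mem_repClass_or G with ⟨j, hj⟩ | h0
  · exact absurd hv (not_vanishes_of_mem_classReps hj)
  · exact h0

theorem iUnion_repClass : ⋃ j, repClass (classReps j) = {G : EdgeGraph 4 | ¬ G.Vanishes} := by
  ext G
  simp only [Set.mem_iUnion, Set.mem_ofPred_eq]
  refine ⟨fun ⟨j, hj⟩ => not_vanishes_of_mem_classReps hj, fun hv => ?_⟩
  rcases mem_repClass_or G with h | h0
  · exact h
  · exact absurd (vanishes_of_mem_zeroReps h0) hv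

theorem setOf_not_vanishes : {G : EdgeGraph 4 | ¬ G.Vanishes} = repClass zeroRepsᶜ := by
  ext G
  rw [← Set.compl_ofPred, setOf_vanishes, Set.mem_compl_iff]
  constructor
  · intro h
    obtain ⟨i, hi⟩ := exists_equiv_repGraph G
    exact ⟨i, Finset.mem_compl.2 fun h0 => h ⟨i, h0, hi⟩, hi⟩
  · rintro ⟨i, hi, h⟩ ⟨j, hj, h'⟩
    obtain rfl := eq_of_repGraph_equiv (Setoid.trans (Setoid.symm h) h')
    exact Finset.mem_compl.1 hi hj

theorem equivalentAt_iff {G H : EdgeGraph 4} {i j : Fin 4} (hG : G ∈ repClass (classReps i))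
    (hH : H ∈ repClass (classReps j)) {N : ℕ} (hGN : G.n ≤ N) (hHN : H.n ≤ N) :
    EdgeGraph.EquivalentAt N G H ↔ i = j := by
  constructor
  · intro h
    obtain ⟨_, _, hG'⟩ := id hG
    obtain ⟨_, _, hH'⟩ := id hH
    obtain ⟨-, D, hD, -⟩ := exists_orientation hG'
    obtain ⟨-, E, hE, -⟩ := exists_orientation hH'
    obtain ⟨-, -, c, hc⟩ := h D E hD hE
    obtain ⟨hi, a, ha, haD⟩ := exists_eq_smul_mainSym hG hD hGN
    obtain ⟨hj, b, hb, hbE⟩ := exists_eq_smul_mainSym hH hE hHN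
    refine eq_of_mainSym_eq_smul hi hj (c := a⁻¹ * (c * b)) ?_
    rw [mul_smul, mul_smul, ← hbE, ← hc, haD, inv_smul_smul₀ ha]
  · rintro rfl D E hD hE
    obtain ⟨hi, a, ha, haD⟩ := exists_eq_smul_mainSym hG hD hGN
    obtain ⟨hj, b, hb, hbE⟩ := exists_eq_smul_mainSym hH hE hHN
    refine ⟨symMonomial_ne_zero hG hD hGN, symMonomial_ne_zero hH hE hHN, a * b⁻¹, ?_⟩
    rw [haD, hbE, mul_smul, inv_smul_smul₀ hb]

theorem sosAt_of_isSumSq_mainSym {G : EdgeGraph 4} {j : Fin 4} (hG : G ∈ repClass (classReps j))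
    {N : ℕ} (hN : G.n ≤ N) (hj : IsSumSq (mainSym N j)) : EdgeGraph.SosAt N G := by
  obtain ⟨i, hi, h⟩ := hG
  obtain ⟨hn, D, hD, hDN⟩ := exists_orientation h
  obtain ⟨k, hk, hkN⟩ := exists_smul_symEdges_eq j i hi
  refine ⟨D, hD, ?_⟩
  rw [hDN N hN, hkN N (hn.trans_le hN)]
  exact IsSumSq.smul_mvPolynomial hj hk.le

theorem EdgeGraph.SosAt.nonnegAt {d N : ℕ} {G : EdgeGraph d} (h : EdgeGraph.SosAt N G) :
    EdgeGraph.NonnegAt N G := by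
  obtain ⟨D, hD, hsum⟩ := h
  exact ⟨D, hD, IsSumSq.eval_nonneg hsum⟩

theorem thirdDigraph_eq : thirdDigraph = digraphOfEdges 4 (repEdges (mainRep 2)) := by
  have h : ∀ i j, thirdDigraph.adj i j = (digraphOfEdges 4 (repEdges (mainRep 2))).adj i j := by
    decide
  rw [DiMultigraph.mk.injEq]
  exact funext fun i => funext fun j => h i j

theorem laxDigraph_eq : laxDigraph = digraphOfEdges 5 (repEdges (mainRep 3)) := by
  have h : ∀ i j, laxDigraph.adj i j = (digraphOfEdges 5 (repEdges (mainRep 3))).adj i j := by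
    decide
  rw [DiMultigraph.mk.injEq]
  exact funext fun i => funext fun j => h i j

theorem thirdGraph_equiv : thirdGraph ≈ repGraph (mainRep 2) := by
  refine ⟨Equiv.refl (Fin 4), fun u v => ?_⟩
  change (digraphOfEdges 4 (repEdges (mainRep 2))).toMultigraph.mult s(u, v) =
    thirdDigraph.toMultigraph.mult s(u, v)
  rw [thirdDigraph_eq]

theorem laxGraph_equiv : laxGraph ≈ repGraph (mainRep 3) := by
  refine ⟨Equiv.refl (Fin 5), fun u v => ?_⟩
  change (digraphOfEdges 5 (repEdges (mainRep 3))).toMultigraph.mult s(u, v) =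
    laxDigraph.toMultigraph.mult s(u, v)
  rw [laxDigraph_eq]

theorem repClass_singleton {A : Finset (Fin 23)} {i : Fin 23} (hA : A = {i}) {G : EdgeGraph 4}
    (hG : G ≈ repGraph i) : repClass A = {H | H ≈ G} := by
  subst hA
  ext H
  simp only [repClass, Finset.mem_singleton, exists_eq_left, Set.mem_ofPred_eq]
  exact ⟨fun h => Setoid.trans h (Setoid.symm hG), fun h => Setoid.trans h hG⟩

theorem pad_thirdDigraph {N : ℕ} (hN : 4 ≤ N) :
    (thirdDigraph.pad N).symMonomial = mainSym N 2 := by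
  rw [thirdDigraph_eq]
  exact pad_symMonomial_digraphOfEdges hN (repEdges_fst_ne_snd _) (lt_repSize (i := mainRep 2))

theorem pad_laxDigraph {N : ℕ} (hN : 5 ≤ N) :
    (laxDigraph.pad N).symMonomial = mainSym N 3 := by
  rw [laxDigraph_eq]
  exact pad_symMonomial_digraphOfEdges hN (repEdges_fst_ne_snd _) (lt_repSize (i := mainRep 3))

theorem isSquareGraph_repGraph {i : Fin 23}
    (h : ∀ e ∈ undirected (repEdges i), Even ((undirected (repEdges i)).count e)) :
    (repGraph i).graph.IsSquareGraph := by
  intro e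
  induction e with | _ u v
  have hmult : (repGraph i).graph.mult s(u, v) = (undirected (repEdges i)).count s(u.1, v.1) :=
    mult_digraphOfEdges (repEdges_fst_ne_snd i) u v
  rw [hmult]
  by_cases hmem : s(u.1, v.1) ∈ undirected (repEdges i)
  · exact h _ hmem
  · rw [Multiset.count_eq_zero.2 hmem]
    exact Even.zero

theorem exists_thirdDigraph_symMonomial_eq :
    ∃ q : MvPolynomial (Fin 3) ℝ, thirdDigraph.symMonomial =
      aeval (fun i : Fin 3 => (X i.castSucc - X (Fin.last 3) : MvPolynomial (Fin 4) ℝ)) q := by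
  let y : Fin 4 → MvPolynomial (Fin 3) ℝ := Fin.snoc X 0
  have hy : ∀ i, aeval (fun i : Fin 3 => (X i.castSucc - X (Fin.last 3) : MvPolynomial (Fin 4) ℝ))
      (y i) = X i - X (Fin.last 3) := by
    intro i
    induction i using Fin.lastCases with
    | last => rw [show y (Fin.last 3) = 0 from Fin.snoc_last _ _, map_zero, sub_self]
    | cast i => rw [show y i.castSucc = X i from Fin.snoc_castSucc _ _ _, aeval_X]
  -- The witness sets the last variable to zero. Nothing is lost, since only differences of
  -- variables occur and these are invariant under translation.
  refine ⟨∑ σ : Equiv.Perm (Fin 4), ∏ i, ∏ j, (y (σ i) - y (σ j)) ^ thirdDigraph.adj i j, ?_⟩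
  simp only [DiMultigraph.symMonomial, DiMultigraph.graphMonomial, map_sum, map_prod, map_pow,
    map_sub, rename_X, hy, sub_sub_sub_cancel_right]

theorem nonneg_and_not_sos_iff (G : EdgeGraph 4) : (G.Nonneg ∧ ¬ G.Sos) ↔ G ≈ laxGraph := by
  constructor
  · rintro ⟨-, hns⟩
    by_contra hne
    refine hns ?_
    rcases mem_repClass_or G with ⟨j, hj⟩ | h0
    · refine sosAt_of_isSumSq_mainSym hj le_rfl ?_
      fin_cases j
      · exact isSumSq_mainSym_zero _
      · exact isSumSq_mainSym_one _
      · obtain ⟨i, hi, h⟩ := id hj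
        refine isSumSq_mainSym_two ?_
        rw [← (exists_orientation h).1]
        exact repSize_mainRep_le 2 i hi
      · refine absurd ?_ hne
        have : repClass (classReps 3) = {H | H ≈ laxGraph} :=
          repClass_singleton rfl laxGraph_equiv
        exact this.subset hj
    -- A graph with vanishing symmetrized monomial is trivially a sum of squares, so it is no
    -- further exception.
    · obtain ⟨i, -, h⟩ := id h0
      obtain ⟨-, D, hD, -⟩ := exists_orientation h
      refine ⟨D, hD, ?_⟩
      rw [D.pad_self, vanishes_of_mem_zeroReps h0 D hD]
      exact IsSumSq.zero
  · intro h
    have h' : G ≈ repGraph (mainRep 3) := Setoid.trans h laxGraph_equiv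
    obtain ⟨hn, D, hD, hDN⟩ := exists_orientation h'
    obtain ⟨n, graph, hedges, hiso⟩ := G
    obtain rfl : 5 = n := hn
    refine ⟨⟨D, hD, fun x => ?_⟩, ?_⟩
    · rw [hDN _ le_rfl]
      exact eval_mainSym_three_nonneg le_rfl x
    · rintro ⟨E, hE, hsum⟩
      exact not_isSumSq_of_eq_or_eq_neg (symMonomial_eq_or_eq_neg h' hE le_rfl) hsum

theorem exists_square_graph_combination :
    ∃ S : EdgeGraph 4, S.graph.IsSquareGraph ∧ S.n ≤ 5 ∧
      ∃ E : DiMultigraph (Fin S.n), E.IsOrientationOf S.graph ∧ (∀ i j, Even (E.adj i j)) ∧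
        ∃ α β : ℝ, 0 < α ∧ 0 < β ∧ ∀ N, 5 ≤ N → (thirdDigraph.pad N).symMonomial =
          α • (laxDigraph.pad N).symMonomial + β • (E.pad N).symMonomial := by
  -- The square graph is a pair of disjoint double edges. The coefficients 1 and 1/4 come from
  -- solving 4L = 4T - S for T.
  refine ⟨repGraph 9, isSquareGraph_repGraph (by decide), by decide, repDigraph 9, rfl,
    by decide, 1, 1 / 4, one_pos, by norm_num, fun N hN => ?_⟩
  have h9 : ((repDigraph 9).pad N).symMonomial = mainSym N 1 :=
    pad_symMonomial_digraphOfEdges (le_trans (by decide) hN) (repEdges_fst_ne_snd 9) lt_repSize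
  rw [pad_thirdDigraph (by omega), pad_laxDigraph hN]
  refine Eq.trans ?_ (congrArg (fun p => (1 : ℝ) • mainSym N 3 + (1 / 4 : ℝ) • p) h9.symm)
  rw [one_smul, smul_eq_C_mul]
  have h4 : (C (1 / 4) : MvPolynomial (Fin N) ℝ) * 4 = 1 := by
    rw [← map_ofNat C 4, ← C_mul]
    norm_num
  linear_combination (-C (1 / 4)) * mainSym_three_eq hN + (mainSym N 3 - mainSym N 2) * h4

end SymGraph

theorem mainTheorem3 :
    -- there are 23 graphs with 4 edges; for 10 of them the polynomial vanishes identically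
    SymGraph.EdgeGraph.isoCount (Set.univ : Set (SymGraph.EdgeGraph 4)) = 23 ∧
    SymGraph.EdgeGraph.isoCount {G : SymGraph.EdgeGraph 4 | G.Vanishes} = 10 ∧
    SymGraph.EdgeGraph.isoCount {G : SymGraph.EdgeGraph 4 | ¬ G.Vanishes} = 13 ∧
    -- the remaining ones form four equivalence classes
    (∃ C : Fin 4 → Set (SymGraph.EdgeGraph 4),
      (⋃ i, C i) = {G | ¬ G.Vanishes} ∧
      (∀ i, (C i).Nonempty) ∧
      (∀ i j, ∀ G ∈ C i, ∀ H ∈ C j, ∀ N, G.n ≤ N → H.n ≤ N →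
        (SymGraph.EdgeGraph.EquivalentAt N G H ↔ i = j)) ∧
      SymGraph.EdgeGraph.isoCount (C 0) = 3 ∧
      SymGraph.EdgeGraph.isoCount (C 1) = 8 ∧
      C 2 = {G | G ≈ SymGraph.thirdGraph} ∧
      C 3 = {G | G ≈ SymGraph.laxGraph} ∧
      -- the first two classes contain square graphs
      (∃ G ∈ C 0, G.graph.IsSquareGraph) ∧
      (∃ G ∈ C 1, G.graph.IsSquareGraph) ∧
      (∀ G ∈ C 0 ∪ C 1, ∀ N, G.n ≤ N →
        SymGraph.EdgeGraph.SosAt N G ∧ SymGraph.EdgeGraph.NonnegAt N G)) ∧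
    -- the third graph is a positive combination of the Lax graph and a square graph
    (∃ S : SymGraph.EdgeGraph 4, S.graph.IsSquareGraph ∧ S.n ≤ 5 ∧
      ∃ E : SymGraph.DiMultigraph (Fin S.n), E.IsOrientationOf S.graph ∧
        (∀ i j, Even (E.adj i j)) ∧
        ∃ α β : ℝ, 0 < α ∧ 0 < β ∧ ∀ N, 5 ≤ N →
          (SymGraph.thirdDigraph.pad N).symMonomial =
            α • (SymGraph.laxDigraph.pad N).symMonomial + β • (E.pad N).symMonomial) ∧
    -- it effectively depends on three variables only; it is non-negative and SOS
    (∃ q : MvPolynomial (Fin 3) ℝ, SymGraph.thirdDigraph.symMonomial =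
      MvPolynomial.aeval (fun i : Fin 3 =>
        (MvPolynomial.X i.castSucc - MvPolynomial.X (Fin.last 3) :
          MvPolynomial (Fin 4) ℝ)) q) ∧
    (∀ N, 4 ≤ N → (∀ x : Fin N → ℝ,
        0 ≤ MvPolynomial.eval x (SymGraph.thirdDigraph.pad N).symMonomial) ∧
      IsSumSq (SymGraph.thirdDigraph.pad N).symMonomial) ∧
    -- the Lax graph is the only non-negative graph with 4 edges that is not SOS
    (∀ N, 5 ≤ N → ∀ x : Fin N → ℝ,
      0 ≤ MvPolynomial.eval x (SymGraph.laxDigraph.pad N).symMonomial) ∧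
    (∀ G : SymGraph.EdgeGraph 4, (G.Nonneg ∧ ¬ G.Sos) ↔ G ≈ SymGraph.laxGraph) := by

  open SymGraph in
  refine ⟨?_, ?_, ?_, ⟨fun j => repClass (classReps j), iUnion_repClass, ?_, ?_, ?_, ?_, ?_, ?_,
    ?_, ?_, ?_⟩, exists_square_graph_combination, exists_thirdDigraph_symMonomial_eq, ?_, ?_,
    nonneg_and_not_sos_iff⟩
  · rw [← repClass_univ, isoCount_repClass]
    rfl
  · rw [setOf_vanishes, isoCount_repClass]
    rfl
  · rw [setOf_not_vanishes, isoCount_repClass]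
    rfl
  · intro j
    have hj : mainRep j ∈ classReps j := by decide +revert
    exact ⟨repGraph (mainRep j), mainRep j, hj, Setoid.refl _⟩
  · exact fun i j G hG H hH N hGN hHN => equivalentAt_iff hG hH hGN hHN
  · rw [isoCount_repClass]
    rfl
  · rw [isoCount_repClass]
    rfl
  · exact repClass_singleton rfl thirdGraph_equiv
  · exact repClass_singleton rfl laxGraph_equiv
  · exact ⟨repGraph 0, ⟨0, by decide, Setoid.refl _⟩, isSquareGraph_repGraph (by decide)⟩
  · exact ⟨repGraph 9, ⟨9, by decide, Setoid.refl _⟩, isSquareGraph_repGraph (by decide)⟩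
  · intro G hG N hN
    have hsos : EdgeGraph.SosAt N G := by
      rcases hG with hG | hG
      · exact sosAt_of_isSumSq_mainSym hG hN (isSumSq_mainSym_zero N)
      · exact sosAt_of_isSumSq_mainSym hG hN (isSumSq_mainSym_one N)
    exact ⟨hsos, hsos.nonnegAt⟩
  · intro N hN
    rw [pad_thirdDigraph hN]
    exact ⟨IsSumSq.eval_nonneg (isSumSq_mainSym_two hN), isSumSq_mainSym_two hN⟩
  · intro N hN x
    rw [pad_laxDigraph hN]
    exact eval_mainSym_three_nonneg hN x
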